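/- A digraph $G$ consists of a set of vertices $V(G)$ and a set of arrows $E(G)\subseteq V(G)\times V(G)$ containing all degenerate arrows $(g,g)$; a digraph map is a map of vertices sending arrows to arrows. Write $\mathsf{DGra}$ for the resulting category. The box product $G\otimes H$ has vertices $V(G)\times V(H)$, with an arrow $(g,h)\to(g',h')$ iff either $g\to g'$ is an arrow and $h=h'$, or $g=g'$ and $h\to h'$ is an arrow. Let $I_1$ be the digraph $0\to 1$. Let $\Box$ be the box category with both connections: its objects are the posets $[1]^n$, $n\ge 0$, and its morphisms are the compositions of the coface maps (insert a coordinate $\varepsilon\in\{0,1\}$), the codegeneracy maps (delete a coordinate) and the coconnections (replace two consecutive coordinates by their maximum or by their minimum). Cubical sets are the functors $\Box^{\mathrm{op}}\to\mathsf{Set}$, and $\mathsf{cSet}$ is their category. It carries the Grothendieck model structure: cofibrations are the monomorphisms; fibrations are the maps with the right lifting property with respect to all open box inclusions $\sqcap^n_{i,\varepsilon}\hookrightarrow\Box^n$ ($n\geq 1$); fibrant objects are called Kan complexes; weak equivalences are the maps $X\to Y$ inducing a bijection $[Y,K]\to[X,K]$ of sets of homotopy classes of maps (with respect to the cylinder $-\otimes\Box^1$)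 for every Kan complex $K$. The cubical nerve $N_1:\mathsf{DGra}\to\mathsf{cSet}$ is the functor $(N_1G)_n=\mathrm{Hom}(I_1^{\otimes n},G)$, whose cubical structure maps are given on the vertices $\{0,1\}^n$ of $I_1^{\otimes n}$ by the formulas of $\Box$. An induced subdigraph $H\subseteq G$ is in-closed (resp. out-closed) if every arrow of $G$ with target in $H$ (resp. source in $H$) also has its source (resp. target) in $H$. Let $\mathsf{Out}(H)$ be the least out-closed subdigraph of $G$ containing $H$, and let $\mathsf{dist}(g,g')\in\mathbb N\cup\{\infty\}$ be the length of a shortest directed path from $g$ to $g'$. An in-closed subdigraph $H\subseteq G$ is a directed deformation retract of $G$ if there is a digraph map $\eta:G\to G$ such that (1) there is an arrow $\eta(g)\to g$ for every vertex $g$ of $G$; (2) $\eta(h)=h$ for every $h\in H$; (3) $\mathsf{dist}(h,g)=\mathsf{dist}(h,\eta(g))+1$ for all $g\in G\setminus H$ and $h\in H$. An in-closed subdigraph $H\subseteq G$ is an ODDR-subdigraph if it is a directed deformation retract of $\mathsf{Out}(H)$. An in-closed cofibration is an injective digraph map $i:H\to G$ whose image is an induced, in-closed subdigraph which is an ODDR-subdigraph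 of $G$. **Theorem.** The functor $N_1:\mathsf{DGra}\to\mathsf{cSet}$ sends pushouts along in-closed cofibrations to homotopy pushouts. That is, for every in-closed cofibration $i:H\to G$, every digraph map $\varphi:H\to H'$ and every pushout square in $\mathsf{DGra}$ $$\begin{array}{ccc} H & \xrightarrow{\ \varphi\ } & H'\\ {\scriptstyle i}\downarrow & & \downarrow\\ G & \longrightarrow & G'\end{array}$$ the square of cubical sets $$\begin{array}{ccc} N_1H & \longrightarrow & N_1H'\\ \downarrow & & \downarrow\\ N_1G & \longrightarrow & N_1G'\end{array}$$ is a homotopy pushout in the above model structure: replacing $N_1H\to N_1G$ by a cofibration $N_1H\to B$ followed by a weak equivalence $B\to N_1G$, the induced map $B\sqcup_{N_1H}N_1H'\to N_1G'$ is a weak equivalence. -/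

import Mathlib

open CategoryTheory Opposite

universe u v w

/-! ### Reflexive digraphs -/

/-- A digraph: a set of vertices with a set of arrows `E ⊆ V × V` containing all the degenerate
arrows `(g, g)`. -/
structure DGra : Type (u + 1) where
  V : Type u
  graph : Digraph V
  refl : ∀ g, graph.Adj g g

namespace DGra

/-- `G.Arr g g'`: there is an arrow `g → g'` (possibly degenerate). -/
abbrev Arr (G : DGra.{u}) (g g' : G.V) : Prop := G.graph.Adj g g'

/-- A map of digraphs: a map of vertices sending arrows to (possibly degenerate) arrows. -/
@[ext]
structure Hom (G : DGra.{u}) (H : DGra.{v}) where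
  toFun : G.V → H.V
  map_arr : ∀ {g g' : G.V}, G.Arr g g' → H.Arr (toFun g) (toFun g')

/-- The composition of digraph maps. -/
def Hom.comp {G : DGra.{u}} {H : DGra.{v}} {K : DGra.{w}} (ψ : Hom H K) (φ : Hom G H) :
    Hom G K where
  toFun g := ψ.toFun (φ.toFun g)
  map_arr h := ψ.map_arr (φ.map_arr h)

instance : Category.{u} DGra.{u} where
  Hom G H := Hom G H
  id G := ⟨fun g => g, fun h => h⟩
  comp φ ψ := Hom.comp ψ φ

variable (G : DGra.{u})

/-- The induced subdigraph on a set of vertices. -/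
def induce (S : Set G.V) : DGra.{u} where
  V := S
  graph := ⟨fun g g' => G.Arr g.1 g'.1⟩
  refl g := G.refl g.1

/-- The induced subdigraph on `S` is in-closed: every arrow with target in `S` has its source
in `S`. -/
def InClosed (S : Set G.V) : Prop := ∀ ⦃g g' : G.V⦄, G.Arr g g' → g' ∈ S → g ∈ S

/-- The induced subdigraph on `S` is out-closed: every arrow with source in `S` has its target
in `S`. -/
def OutClosed (S : Set G.V) : Prop := ∀ ⦃g g' : G.V⦄, G.Arr g g' → g ∈ S → g' ∈ S

/-- The (vertex set of the) out-closure `Out(S)`: the least out-closed subdigraph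
containing `S`. -/
def outClosure (S : Set G.V) : Set G.V := ⋂₀ {T | G.OutClosed T ∧ S ⊆ T}

/-- There is a directed path with `n` arrows from `g` to `g'`. -/
def HasPath : ℕ → G.V → G.V → Prop
  | 0, g, g' => g = g'
  | n + 1, g, g' => ∃ a, HasPath n g a ∧ G.Arr a g'

/-- The directed distance: the least length of a directed path from `g` to `g'`, and `⊤` if there
is none. Degenerate arrows may occur in a path, which does not affect the least length. -/
noncomputable def dist (g g' : G.V) : ℕ∞ := ⨅ (n : ℕ) (_ : G.HasPath n g g'), (n : ℕ∞)

/-- The induced subdigraph on `S` is a directed deformation retract of `G`. -/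
def IsDirectedDeformationRetract (S : Set G.V) : Prop :=
  G.InClosed S ∧ ∃ η : G ⟶ G,
    (∀ g, G.Arr (η.toFun g) g) ∧
    (∀ h ∈ S, η.toFun h = h) ∧
    (∀ g ∉ S, ∀ h ∈ S, G.dist h g = G.dist h (η.toFun g) + 1)

/-- The induced subdigraph on `S` is an ODDR-subdigraph: it is in-closed in `G` and a directed
deformation retract of its out-closure. -/
def IsODDR (S : Set G.V) : Prop :=
  G.InClosed S ∧
    (G.induce (G.outClosure S)).IsDirectedDeformationRetract {g | g.1 ∈ S}

variable {G}

/-- An in-closed inclusion: an injective digraph map whose image is an induced and in-closed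
subdigraph. -/
def IsInClosedInclusion {H : DGra.{u}} (i : H ⟶ G) : Prop :=
  Function.Injective i.toFun ∧
    (∀ ⦃h h' : H.V⦄, G.Arr (i.toFun h) (i.toFun h') → H.Arr h h') ∧
    G.InClosed (Set.range i.toFun)

/-- An in-closed cofibration: an in-closed inclusion whose image is an ODDR-subdigraph. -/
def IsInClosedCofibration {H : DGra.{u}} (i : H ⟶ G) : Prop :=
  IsInClosedInclusion i ∧ G.IsODDR (Set.range i.toFun)

/-- The digraph `I₁ : 0 → 1` (with `false = 0` and `true = 1`). -/
def I₁ : DGra.{0} where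
  V := Bool
  graph := ⟨fun a b => a ≤ b⟩
  refl _ := le_rfl

/-- The `n`-fold box power `J ⊗ ⋯ ⊗ J`: an arrow `x → y` changes at most one coordinate, and that
one along an arrow of `J`. For `n = 0` it is the one-point digraph. -/
def boxPow (J : DGra.{u}) (n : ℕ) : DGra.{u} where
  V := Fin n → J.V
  graph := ⟨fun x y => x = y ∨ ∃ i, J.Arr (x i) (y i) ∧ ∀ j, j ≠ i → x j = y j⟩
  refl _ := Or.inl rfl

end DGra

/-! ### The box category with both connections -/

/-- The vertices of the poset `[1]ⁿ` (with `false = 0` and `true = 1`). -/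
abbrev Cube (n : ℕ) : Type := Fin n → Bool

namespace Cube

/-- The coface map `∂^{i,ε} : [1]ⁿ → [1]ⁿ⁺¹`, inserting `ε` as the `i`-th coordinate. -/
def coface {n : ℕ} (i : Fin (n + 1)) (ε : Bool) (x : Cube n) : Cube (n + 1) :=
  Fin.insertNth (α := fun _ => Bool) i ε x

/-- The codegeneracy map `σ^i : [1]ⁿ⁺¹ → [1]ⁿ`, forgetting the `i`-th coordinate. -/
def codegeneracy {n : ℕ} (i : Fin (n + 1)) (x : Cube (n + 1)) : Cube n :=
  fun j => x (i.succAbove j)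

/-- The coconnection `γ^{i,ε} : [1]ⁿ⁺² → [1]ⁿ⁺¹`, replacing the consecutive coordinates
`x_i, x_{i+1}` by their maximum if `ε = 0` and by their minimum if `ε = 1`. -/
def coconnection {n : ℕ} (i : Fin (n + 1)) (ε : Bool) (x : Cube (n + 2)) : Cube (n + 1) :=
  fun j =>
    if j < i then x j.castSucc
    else if j = i then
      (if ε then min (x i.castSucc) (x i.succ) else max (x i.castSucc) (x i.succ))
    else x j.succ

/-- The product `f × id : [1]ⁿ⁺¹ → [1]ᵐ⁺¹` (the new coordinate is the last one). -/
def tensorInterval {n m : ℕ} (f : Cube n → Cube m) (x : Cube (n + 1)) : Cube (m + 1) :=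
  Fin.snoc (α := fun _ => Bool) (f (Fin.init x)) (x (Fin.last n))

end Cube

/-- The maps of the box category: compositions of coface, codegeneracy and coconnection maps. -/
inductive IsBoxMap : ∀ {n m : ℕ}, (Cube n → Cube m) → Prop
  | id (n : ℕ) : IsBoxMap (fun x : Cube n => x)
  | comp {n m k : ℕ} {f : Cube n → Cube m} {g : Cube m → Cube k} :
      IsBoxMap f → IsBoxMap g → IsBoxMap (fun x => g (f x))
  | coface {n : ℕ} (i : Fin (n + 1)) (ε : Bool) : IsBoxMap (Cube.coface i ε)
  | codegeneracy {n : ℕ} (i : Fin (n + 1)) : IsBoxMap (Cube.codegeneracy i)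
  | coconnection {n : ℕ} (i : Fin (n + 1)) (ε : Bool) : IsBoxMap (Cube.coconnection i ε)

/-- The box category; the object `⟨n⟩` is `[1]ⁿ`. -/
structure Box : Type where
  dim : ℕ

namespace Box

/-- The morphisms of the box category. -/
@[ext]
structure Hom (a b : Box) where
  toFun : Cube a.dim → Cube b.dim
  isBoxMap : IsBoxMap toFun

instance : Category.{0} Box where
  Hom a b := Hom a b
  id a := ⟨fun x => x, .id _⟩
  comp f g := ⟨fun x => g.toFun (f.toFun x), f.isBoxMap.comp g.isBoxMap⟩

/-- The coface map as a morphism of the box category. -/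
def coface {n : ℕ} (i : Fin (n + 1)) (ε : Bool) : (⟨n⟩ : Box) ⟶ ⟨n + 1⟩ :=
  ⟨Cube.coface i ε, .coface i ε⟩

end Box

theorem Cube.tensorInterval_coface {n : ℕ} (i : Fin (n + 1)) (ε : Bool) :
    Cube.tensorInterval (Cube.coface i ε) = Cube.coface i.castSucc ε := by
  funext x j
  induction j using Fin.lastCases with
  | last =>
    have h : Fin.last (n + 1) = i.castSucc.succAbove (Fin.last n) := by
      rw [Fin.succAbove_of_le_castSucc _ _ (by simpa using Fin.le_last i), Fin.succ_last]
    have h' := Fin.insertNth_apply_succAbove (α := fun _ => Bool) i.castSucc ε x (Fin.last n)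
    rw [← h] at h'
    simp [Cube.tensorInterval, Cube.coface, h']
  | cast j =>
    simp only [Cube.tensorInterval, Fin.snoc_castSucc, Cube.coface]
    by_cases hj : j = i
    · subst hj; simp
    · obtain ⟨k, rfl⟩ := Fin.exists_succAbove_eq hj
      have h' := Fin.insertNth_apply_succAbove (α := fun _ => Bool) i.castSucc ε x k.castSucc
      rw [Fin.castSucc_succAbove_castSucc] at h'
      simp [Fin.init, h']

theorem Cube.tensorInterval_codegeneracy {n : ℕ} (i : Fin (n + 1)) :
    Cube.tensorInterval (Cube.codegeneracy i) = Cube.codegeneracy i.castSucc := by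
  funext x j
  induction j using Fin.lastCases with
  | last =>
    have h : i.castSucc.succAbove (Fin.last n) = Fin.last (n + 1) := by
      rw [Fin.succAbove_of_le_castSucc _ _ (by simpa using Fin.le_last i), Fin.succ_last]
    simp [Cube.tensorInterval, Cube.codegeneracy, h]
  | cast j =>
    simp [Cube.tensorInterval, Cube.codegeneracy, Fin.init, Fin.castSucc_succAbove_castSucc]

theorem Cube.tensorInterval_coconnection {n : ℕ} (i : Fin (n + 1)) (ε : Bool) :
    Cube.tensorInterval (Cube.coconnection i ε) = Cube.coconnection i.castSucc ε := by
  funext x j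
  induction j using Fin.lastCases with
  | last =>
    have h1 : ¬ Fin.last (n + 1) < i.castSucc := by simpa using Fin.le_last _
    have h2 : ¬ Fin.last (n + 1) = i.castSucc := (Fin.castSucc_lt_last i).ne'
    simp only [Cube.tensorInterval, Cube.coconnection, if_neg h1, if_neg h2, Fin.snoc_last,
      Fin.succ_last]
  | cast j =>
    simp only [Cube.tensorInterval, Cube.coconnection, Fin.snoc_castSucc, Fin.init,
      Fin.castSucc_lt_castSucc_iff, Fin.castSucc_inj, Fin.succ_castSucc]

theorem IsBoxMap.tensorInterval {n m : ℕ} {f : Cube n → Cube m} (hf : IsBoxMap f) :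
    IsBoxMap (Cube.tensorInterval f) := by
  induction hf with
  | id n =>
    convert IsBoxMap.id (n + 1) using 2 with x
    simp [Cube.tensorInterval]
  | comp hf hg ihf ihg =>
    convert ihf.comp ihg using 2 with x
    simp [Cube.tensorInterval]
  | coface i ε => rw [Cube.tensorInterval_coface]; exact .coface _ _
  | codegeneracy i => rw [Cube.tensorInterval_codegeneracy]; exact .codegeneracy _
  | coconnection i ε => rw [Cube.tensorInterval_coconnection]; exact .coconnection _ _

/-- The functor `- ⊗ [1] : □ ⥤ □`, `[1]ⁿ ↦ [1]ⁿ⁺¹`, of the monoidal structure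
`[1]ⁿ ⊗ [1]ᵐ = [1]ⁿ⁺ᵐ`. -/
def Box.tensorInterval : Box ⥤ Box where
  obj a := ⟨a.dim + 1⟩
  map f := ⟨Cube.tensorInterval f.toFun, f.isBoxMap.tensorInterval⟩
  map_id a := by
    apply Box.Hom.ext; funext x
    change Fin.snoc (α := fun _ => Bool) (Fin.init x) (x (Fin.last _)) = x
    simp
  map_comp f g := by
    apply Box.Hom.ext; funext x
    change Cube.tensorInterval (fun y => g.toFun (f.toFun y)) x =
      Cube.tensorInterval g.toFun (Cube.tensorInterval f.toFun x)
    simp [Cube.tensorInterval]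

/-- The two endpoint inclusions `[1]ⁿ ≅ [1]ⁿ ⊗ [1]⁰ → [1]ⁿ ⊗ [1]`. -/
def Box.endpoint (ε : Bool) : 𝟭 Box ⟶ Box.tensorInterval where
  app a := Box.coface (Fin.last a.dim) ε
  naturality a b f := by
    apply Box.Hom.ext; funext x
    change Cube.coface (Fin.last _) ε (f.toFun x) =
      Cube.tensorInterval f.toFun (Cube.coface (Fin.last _) ε x)
    simp [Cube.coface, Cube.tensorInterval]

/-! ### Cubical sets -/

/-- Cubical sets: presheaves on the box category. -/
abbrev CSet : Type (u + 1) := Boxᵒᵖ ⥤ Type u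

namespace CSet

/-- The standard cube `□ⁿ`. -/
abbrev stdCube (n : ℕ) : CSet.{u} := uliftYoneda.{u}.obj (⟨n⟩ : Box)

/-- The open box `⊓ⁿ⁺¹_{i,ε} ⊆ □ⁿ⁺¹`: the union of all the faces `∂^{j,δ}(□ⁿ)` with
`(j,δ) ≠ (i,ε)`. -/
def horn (n : ℕ) (i : Fin (n + 1)) (ε : Bool) : Subfunctor (stdCube.{u} (n + 1)) where
  obj a := {f | ∃ (j : Fin (n + 1)) (δ : Bool) (g : a.unop ⟶ (⟨n⟩ : Box)),
    (j, δ) ≠ (i, ε) ∧ f.down = g ≫ Box.coface j δ}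
  map {a b} k := by
    rintro f ⟨j, δ, g, hne, hf⟩
    refine ⟨j, δ, k.unop ≫ g, hne, ?_⟩
    change k.unop ≫ f.down = _
    rw [hf, Category.assoc]

/-- A Kan complex: a cubical set in which every open box has a filler. -/
def IsKan (K : CSet.{u}) : Prop :=
  ∀ (n : ℕ) (i : Fin (n + 1)) (ε : Bool) (f : (horn.{u} n i ε).toFunctor ⟶ K),
    ∃ g : stdCube.{u} (n + 1) ⟶ K, (horn.{u} n i ε).ι ≫ g = f

/-- The cubical set `Hom(□¹, Y)` of paths in `Y`, whose `n`-cubes are the maps `□ⁿ ⊗ □¹ ⟶ Y`, that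
is the `n+1`-cubes of `Y`. It is the value at `Y` of the right adjoint of the cylinder functor
`- ⊗ □¹`. -/
abbrev path (Y : CSet.{u}) : CSet.{u} := Box.tensorInterval.op ⋙ Y

/-- The evaluation of paths at the endpoint `ε`. -/
def path.eval (Y : CSet.{u}) (ε : Bool) : path Y ⟶ Y :=
  Functor.whiskerRight (NatTrans.op (Box.endpoint ε)) Y

/-- An elementary homotopy from `f` to `g`, that is a map `X ⊗ □¹ ⟶ Y` restricting to `f` and `g`
at the two ends, given by its adjoint `X ⟶ Hom(□¹, Y)`. -/
def ElementaryHomotopic {X Y : CSet.{u}} (f g : X ⟶ Y) : Prop :=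
  ∃ h : X ⟶ path Y, h ≫ path.eval Y false = f ∧ h ≫ path.eval Y true = g

/-- The set `[X, Y]` of homotopy classes of maps, i.e. the quotient by the equivalence relation
generated by elementary homotopies. -/
def HomotopyClasses (X Y : CSet.{u}) : Type u :=
  Quot (fun f g : X ⟶ Y => ElementaryHomotopic f g)

/-- The map `[Y, Z] → [X, Z]` induced by `f : X ⟶ Y`. -/
def HomotopyClasses.precomp {X Y : CSet.{u}} (f : X ⟶ Y) (Z : CSet.{u}) :
    HomotopyClasses Y Z → HomotopyClasses X Z :=
  Quot.map (fun a => f ≫ a) (by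
    rintro a b ⟨h, rfl, rfl⟩
    exact ⟨f ≫ h, by simp, by simp⟩)

/-- Weak equivalences of cubical sets (in the model structure whose cofibrations are the
monomorphisms and whose fibrations are the maps with the right lifting property against the open
box inclusions): the maps `X ⟶ Y` inducing a bijection `[Y, K] → [X, K]` for every Kan complex
`K`. -/
def WeakEquivalence {X Y : CSet.{u}} (f : X ⟶ Y) : Prop :=
  ∀ K : CSet.{u}, IsKan K → Function.Bijective (HomotopyClasses.precomp f K)

/-- The square
```
A --f--> B
|        |
g        f'
v        v
C --g'-> D
```
is a homotopy pushout: it commutes and, after replacing `f` by a cofibration (a monomorphism)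
`i : A ⟶ B'` with a weak equivalence `p : B' ⟶ B` such that `i ≫ p = f`, the comparison map from
the pushout `P` of `i` and `g` to `D` is a weak equivalence. -/
def IsHomotopyPushout {A B C D : CSet.{u}} (f : A ⟶ B) (g : A ⟶ C) (f' : B ⟶ D) (g' : C ⟶ D) :
    Prop :=
  f ≫ f' = g ≫ g' ∧
    ∃ (B' P : CSet.{u}) (i : A ⟶ B') (p : B' ⟶ B) (inl : B' ⟶ P) (inr : C ⟶ P) (c : P ⟶ D),
      Mono i ∧ WeakEquivalence p ∧ i ≫ p = f ∧ IsPushout i g inl inr ∧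
        inl ≫ c = p ≫ f' ∧ inr ≫ c = g' ∧ WeakEquivalence c

end CSet

/-! ### The cubical nerve -/

/-- Every map of the box category is a digraph map between box powers of `I₁`. -/
theorem IsBoxMap.map_arr {n m : ℕ} {f : Cube n → Cube m} (hf : IsBoxMap f) :
    ∀ {x y : Cube n}, (DGra.I₁.boxPow n).Arr x y → (DGra.I₁.boxPow m).Arr (f x) (f y) := by
  induction hf with
  | id n => exact fun h => h
  | comp _ _ ihf ihg => exact fun h => ihg (ihf h)
  | @coface n i ε =>
    rintro x y (rfl | ⟨k, hk, h⟩)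
    · exact Or.inl rfl
    · refine Or.inr ⟨i.succAbove k, by simpa [Cube.coface] using hk, fun j hj => ?_⟩
      by_cases hji : j = i
      · subst hji; simp [Cube.coface]; rfl
      · obtain ⟨l, rfl⟩ := Fin.exists_succAbove_eq hji
        simpa [Cube.coface] using h l (fun hl => hj (by rw [hl]))
  | @codegeneracy n i =>
    rintro x y (rfl | ⟨k, hk, h⟩)
    · exact Or.inl rfl
    · by_cases hki : k = i
      · subst hki
        exact Or.inl (funext fun j => h _ (Fin.succAbove_ne _ _))
      · obtain ⟨l, rfl⟩ := Fin.exists_succAbove_eq hki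
        exact Or.inr ⟨l, hk, fun j hj => h _ (fun hjl => hj (Fin.succAbove_right_injective hjl))⟩
  | @coconnection n i ε =>
    rintro x y (rfl | ⟨k, hk, h⟩)
    · exact Or.inl rfl
    · have hle : ∀ l, DGra.I₁.Arr (x l) (y l) := fun l => by
        by_cases hl : l = k
        · subst hl; exact hk
        · rw [h l hl]; exact DGra.I₁.refl _
      -- the only coordinate of the value that depends on the `k`-th coordinate of the argument
      obtain ⟨m, hm⟩ : ∃ m : Fin (n + 1), ∀ j, j ≠ m →
          Cube.coconnection i ε x j = Cube.coconnection i ε y j := by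
        have hi := i.isLt
        have hk' := k.isLt
        refine ⟨⟨if k.1 ≤ i.1 then k.1 else k.1 - 1, by split_ifs <;> omega⟩, fun j hj => ?_⟩
        have hj' : j.1 ≠ if k.1 ≤ i.1 then k.1 else k.1 - 1 := fun e => hj (Fin.ext e)
        unfold Cube.coconnection
        by_cases h1 : j < i
        · rw [if_pos h1, if_pos h1]
          refine h _ (fun e => hj' ?_)
          have e' := congrArg Fin.val e
          rw [Fin.lt_def] at h1
          simp only [Fin.val_castSucc] at e'
          rw [if_pos (by omega)]; exact e'
        · rw [if_neg h1, if_neg h1]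
          rw [Fin.lt_def] at h1
          by_cases h2 : j = i
          · subst h2
            have e1 : x j.castSucc = y j.castSucc := h _ (fun e => hj' (by
              have e' := congrArg Fin.val e
              simp only [Fin.val_castSucc] at e'
              rw [if_pos (by omega)]; exact e'))
            have e2 : x j.succ = y j.succ := h _ (fun e => hj' (by
              have e' := congrArg Fin.val e
              simp only [Fin.val_succ] at e'
              rw [if_neg (by omega)]; omega))
            rw [if_pos rfl, if_pos rfl, e1, e2]
          · rw [if_neg h2, if_neg h2]
            have h2' : j.1 ≠ i.1 := fun e => h2 (Fin.ext e)
            refine h _ (fun e => hj' ?_)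
            have e' := congrArg Fin.val e
            simp only [Fin.val_succ] at e'
            rw [if_neg (by omega)]; omega
      refine Or.inr ⟨m, ?_, hm⟩
      change Cube.coconnection i ε x m ≤ Cube.coconnection i ε y m
      unfold Cube.coconnection
      split_ifs
      · exact hle _
      · exact min_le_min (α := Bool) (hle _) (hle _)
      · exact max_le_max (α := Bool) (hle _) (hle _)
      · exact hle _

namespace DGra

/-- The digraph map `I₁^{⊗n} → I₁^{⊗m}` given by a map `[1]ⁿ → [1]ᵐ` of the box category. -/
def cubeMap {a b : Box} (f : a ⟶ b) : Hom (I₁.boxPow a.dim) (I₁.boxPow b.dim) where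
  toFun := f.toFun
  map_arr h := f.isBoxMap.map_arr h

/-- The cubical nerve `N₁`, with `(N₁ G)_n = Hom(I₁^{⊗n}, G)`. -/
def N₁ : DGra.{u} ⥤ CSet.{u} where
  obj G :=
    { obj a := Hom (I₁.boxPow a.unop.dim) G
      map f := TypeCat.ofHom fun x => x.comp (cubeMap f.unop) }
  map φ := { app a := TypeCat.ofHom fun x => Hom.comp φ x }

end DGra

/-!
The nerve of an in-closed cofibration is already a monomorphism, so the homotopy pushout of the
nerves is the plain pushout `P = N₁ G ⊔ N₁ H'` over `N₁ H`, and the comparison map `c : P ⟶ N₁ G'`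
has to be shown to be a weak equivalence. It is not a monomorphism in general: `φ` may identify
the parts in `H` of different cubes of `G`.

*The digraphs.* Let `O` be the out-closure of `H` in `G`, and let `O'` be the union of the images
of `H'` and `O` in `G'`. Since a cube of a digraph has a least and a greatest vertex, a cube of
`G'` whose least vertex is outside `O'` avoids `H'` and is the image of a unique cube of `G`, and
all the other cubes lie in `O'` (`DGra.cell_pushout_cases`, `DGra.eq_of_ev_map_eq`). So
`N₁ G'` is obtained by gluing `N₁ G` and `N₁ O'` along `N₁ O`, and only the passage from `H` to `O`
and from `H'` to `O'` has to be understood. Both are infinite deformation retracts: `η` extends to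
`O'` by the identity of `H'`, there are arrows `η g → g`, and the condition on distances ensures
that iterating `η` moves each vertex into `H`, resp. `H'`
(`DGra.IsODDR.exists_deformation`, `DGra.exists_deformation_outPushout`).

*The homotopy theory.* Only the definition of a Kan complex is used. A map into a cubical set is
treated as a section of a correspondence `R ⊆ Y × E`, which expresses lifting problems without
mentioning the base of a fibration. Two lifting properties of `R`, against boundary inclusions and
against open boxes, play the roles of trivial fibrations and of fibrations.

* `CSet.Corr.BoundaryFilling.exists_extension`: the lifting property against boundary inclusions
  implies that against all monomorphisms. The proof adjoins one cube at a time; this is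
  well defined because the box category has the Eilenberg–Zilber property: a box map with no
  constant coordinate is split, and is determined by its sections (`IsBoxMap.eq_of_sections`).
* `CSet.Corr.KanFilling.pathEnds` and `CSet.Corr.KanFilling.pathFrom`: if `R` has fillers for open
  boxes, so does the correspondence of paths over given paths with given endpoints, and that of
  paths with only a given source has fillers for boundaries (homotopy extension and lifting).
  In particular homotopy of maps into a Kan complex is an equivalence relation.
* `CSet.Corr.KanFilling.exists_extension`: if `R` has fillers for open boxes, a section over the
  nerve of `H` extends to that of `O`, and likewise for `H'` and `O'`: if it is defined on some
  subset, pull it back along `η`, and then carry it along the homotopy from `η` to the identity.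

*Conclusion* (`DGra.exists_section_pushout`). Given compatible sections `a` over `N₁ G` and `b`
over `N₁ H'`, extend `b` to `N₁ O'`. On `N₁ O` this extension and `a` agree on `N₁ H`, hence are
homotopic relatively to `N₁ H`; extending the homotopy to `N₁ G` deforms `a` so that it can be glued
to the extension of `b`. For the correspondence of all pairs with values in a Kan complex this is
the surjectivity of `[N₁ G', K] → [P, K]`, and for the correspondence of the paths in `K` between
the values of two given maps it is the injectivity.
-/

/-! ### Dependence of the coordinates of a box map -/

namespace Cube

/-- The `j`-th output coordinate of `f` depends on the `i`-th input coordinate. -/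
def Dep {n m : ℕ} (f : Cube n → Cube m) (j : Fin m) (i : Fin n) : Prop :=
  ∃ (x : Cube n) (b : Bool), f (Function.update x i b) j ≠ f x j

/-- The value of an output coordinate is determined by the input coordinates on which it depends. -/
theorem eq_of_forall_dep {n m : ℕ} {f : Cube n → Cube m} {j : Fin m} {x y : Cube n}
    (h : ∀ i, Dep f j i → x i = y i) : f x j = f y j := by
  -- the coordinates of `x` are changed into those of `y` one at a time
  suffices H : ∀ s : Finset (Fin n), f (s.piecewise y x) j = f x j by
    have := H Finset.univ
    rwa [Finset.piecewise_univ, eq_comm] at this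
  intro s
  induction s using Finset.induction_on with
  | empty => simp
  | insert a s ha ih =>
    rw [Finset.piecewise_insert, ← ih]
    by_cases hd : Dep f j a
    · have : s.piecewise y x a = y a := by rw [Finset.piecewise_eq_of_notMem _ _ _ ha, h a hd]
      rw [← this, Function.update_eq_self]
    · by_contra hne
      exact hd ⟨_, _, hne⟩

theorem Dep.of_comp {n m k : ℕ} {f : Cube n → Cube m} {g : Cube m → Cube k} {l : Fin k}
    {i : Fin n} (h : Dep (fun x => g (f x)) l i) : ∃ j, Dep f j i ∧ Dep g l j := by
  obtain ⟨x, b, hx⟩ := h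
  by_contra! hcon
  refine hx (eq_of_forall_dep fun j hj => ?_)
  by_contra hne
  exact hcon j ⟨x, b, hne⟩ hj

/-- Every output coordinate of `f` takes both values, i.e. `f` factors through no coface map. -/
def Nonconst {n m : ℕ} (f : Cube n → Cube m) : Prop :=
  ∀ j, ∃ x y, f x j ≠ f y j

theorem coface_codegeneracy {n : ℕ} (i : Fin (n + 1)) (x : Cube (n + 1)) :
    coface i (x i) (codegeneracy i x) = x := by
  funext j
  by_cases h : j = i
  · subst h; simp [coface]
  · obtain ⟨k, rfl⟩ := Fin.exists_succAbove_eq h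
    simp [coface, codegeneracy]

@[simp] theorem coface_same {n : ℕ} (i : Fin (n + 1)) (ε : Bool) (x : Cube n) :
    coface i ε x i = ε := by simp [coface]

@[simp] theorem coface_succAbove {n : ℕ} (i : Fin (n + 1)) (ε : Bool) (x : Cube n) (k : Fin n) :
    coface i ε x (i.succAbove k) = x k := by simp [coface]

@[simp] theorem codegeneracy_coface {n : ℕ} (i : Fin (n + 1)) (ε : Bool) (x : Cube n) :
    codegeneracy i (coface i ε x) = x := by
  funext k; simp [codegeneracy]

end Cube

namespace IsBoxMap

open Cube

theorem monotone {n m : ℕ} {f : Cube n → Cube m} (hf : IsBoxMap f) : Monotone f := by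
  induction hf with
  | id n => exact monotone_id
  | comp _ _ ihf ihg => exact ihg.comp ihf
  | coface i ε =>
    intro x y h j
    by_cases hj : j = i
    · subst hj; simp
    · obtain ⟨k, rfl⟩ := Fin.exists_succAbove_eq hj
      simpa using h k
  | codegeneracy i => exact fun x y h j => h _
  | coconnection i ε =>
    intro x y h j
    unfold Cube.coconnection
    split_ifs
    · exact h _
    · exact min_le_min (α := Bool) (h _) (h _)
    · exact max_le_max (α := Bool) (h _) (h _)
    · exact h _

/-- The blocks of input coordinates on which the output coordinates of a box map depend are
disjoint, and they are ordered as the output coordinates are. -/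
theorem le_of_dep {n m : ℕ} {f : Cube n → Cube m} (hf : IsBoxMap f) :
    ∀ {j j' : Fin m} {i i' : Fin n}, Dep f j i → Dep f j' i' → i ≤ i' → j ≤ j' := by
  induction hf with
  | id n =>
    have key : ∀ {j i : Fin n}, Dep (fun x : Cube n => x) j i → j = i := by
      rintro j i ⟨x, b, h⟩
      by_contra hne
      exact h (Function.update_of_ne hne _ _)
    intro j j' i i' h h' hi
    rwa [key h, key h']
  | comp _ _ ihf ihg =>
    intro l l' i i' h h' hi
    obtain ⟨j, h1, h2⟩ := h.of_comp
    obtain ⟨j', h1', h2'⟩ := h'.of_comp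
    exact ihg h2 h2' (ihf h1 h1' hi)
  | @coface n a ε =>
    have key : ∀ {j i}, Dep (Cube.coface (n := n) a ε) j i → j = a.succAbove i := by
      rintro j i ⟨x, b, h⟩
      by_cases hj : j = a
      · subst hj; simp at h
      · obtain ⟨k, rfl⟩ := Fin.exists_succAbove_eq hj
        by_contra hne
        refine h ?_
        rw [coface_succAbove, coface_succAbove, Function.update_of_ne]
        rintro rfl; exact hne rfl
    intro j j' i i' h h' hi
    rw [key h, key h']
    exact (Fin.strictMono_succAbove a).monotone hi
  | @codegeneracy n a =>
    have key : ∀ {j i}, Dep (Cube.codegeneracy (n := n) a) j i → a.succAbove j = i := by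
      rintro j i ⟨x, b, h⟩
      by_contra hne
      exact h (Function.update_of_ne hne _ _)
    intro j j' i i' h h' hi
    rw [← key h, ← key h'] at hi
    exact (Fin.strictMono_succAbove a).le_iff_le.1 hi
  | @coconnection n a ε =>
    have key : ∀ {j i}, Dep (Cube.coconnection (n := n) a ε) j i →
        j.1 = if i.1 ≤ a.1 then i.1 else i.1 - 1 := by
      rintro j i ⟨x, b, h⟩
      by_contra hne
      refine h ?_
      have hu : ∀ l : Fin (n + 2), l.1 ≠ i.1 → Function.update x i b l = x l :=
        fun l hl => Function.update_of_ne (fun e => hl (congrArg _ e)) _ _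
      unfold Cube.coconnection
      simp only [Fin.lt_def, Fin.ext_iff]
      split_ifs at hne ⊢ <;>
      first
      | (rw [hu, hu] <;> simp <;> omega)
      | (rw [hu] ; simp ; omega)
    intro j j' i i' h h' hi
    have h1 := key h
    have h2 := key h'
    rw [Fin.le_def] at hi ⊢
    split_ifs at h1 h2 <;> omega

theorem nonconst_eq_false {n m : ℕ} {f : Cube n → Cube m} (hf : IsBoxMap f) (h : Nonconst f)
    (j : Fin m) : f (fun _ => false) j = false := by
  obtain ⟨x, y, hxy⟩ := h j
  have h1 := hf.monotone (fun _ => Bool.false_le _ : (fun _ => false) ≤ x) j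
  have h2 := hf.monotone (fun _ => Bool.false_le _ : (fun _ => false) ≤ y) j
  revert h1 h2 hxy
  cases f x j <;> cases f y j <;> cases f (fun _ => false) j <;> simp

/-- A monotone nonconstant Boolean function which is true at `v` has a critical edge below `v`,
i.e. a one-coordinate change at which it jumps. -/
theorem exists_critical_edge {n m : ℕ} {f : Cube n → Cube m} (hf : IsBoxMap f) (h : Nonconst f)
    {j : Fin m} {v : Cube n} (hv : f v j = true) :
    ∃ (u : Cube n) (i : Fin n), f (Function.update u i false) j = false ∧
      f (Function.update u i true) j = true ∧ Function.update u i true ≤ v := by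
  obtain ⟨w, hwv, hw⟩ := (Set.toFinite {w : Cube n | f w j = true}).exists_le_minimal hv
  obtain ⟨i, hi⟩ : ∃ i, w i = true := by
    by_contra! hcon
    have : w = fun _ => false := funext fun i => by simpa using hcon i
    have h1 := hw.prop
    rw [Set.mem_ofPred_eq, this, hf.nonconst_eq_false h] at h1
    cases h1
  have hwi : Function.update w i true = w := by rw [← hi, Function.update_eq_self]
  refine ⟨w, i, ?_, by rw [hwi]; exact hw.prop, by rwa [hwi]⟩
  · by_contra hne
    have h2 : Function.update w i false ≤ w := by
      intro a
      by_cases ha : a = i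
      · subst ha; simp
      · rw [Function.update_of_ne ha]
    have h3 := hw.le_of_le (by simpa using hne) h2 i
    rw [hi, Function.update_self] at h3
    exact (by decide : ¬ (true ≤ false)) h3

/-- The inclusion of a face of a cube, described by its free coordinates `ι`, is a box map. -/
theorem of_strictMono {m : ℕ} : ∀ {n : ℕ} (ι : Fin m → Fin n) (_ : StrictMono ι)
    (s : Cube m → Cube n) (_ : ∀ y j, s y (ι j) = y j)
    (_ : ∀ y y' a, a ∉ Set.range ι → s y a = s y' a), IsBoxMap s := by
  intro n
  induction n with
  | zero =>
    intro ι hι s hs hc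
    have hm : m = 0 := by
      cases m with
      | zero => rfl
      | succ m => exact (ι 0).elim0
    subst hm
    convert IsBoxMap.id 0 using 2
  | succ n ih =>
    intro ι hι s hs hc
    by_cases hsurj : Function.Surjective ι
    · have hm : m = n + 1 := by
        simpa using Fintype.card_of_bijective ⟨hι.injective, hsurj⟩
      subst hm
      have hid : ι = fun j => j := by
        let e : Fin (n + 1) ≃o Fin (n + 1) := hι.orderIsoOfSurjective ι hsurj
        have : e = OrderIso.refl _ := Subsingleton.elim _ _
        funext j
        exact congrArg (fun e : Fin (n + 1) ≃o Fin (n + 1) => e j) this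
      subst hid
      convert IsBoxMap.id (n + 1) using 2 with y
      exact funext fun j => hs y j
    · obtain ⟨a, ha⟩ : ∃ a, a ∉ Set.range ι := by
        simpa [Function.Surjective] using hsurj
      have hne : ∀ j, ∃ k, a.succAbove k = ι j := fun j =>
        Fin.exists_succAbove_eq (fun e => ha ⟨j, e⟩)
      choose ι' hι' using hne
      have hs' : IsBoxMap (fun y => Cube.codegeneracy a (s y)) := by
        refine ih ι' (fun j j' hj => ?_) _ (fun y j => ?_) (fun y y' k hk => ?_)
        · rw [← (Fin.strictMono_succAbove a).lt_iff_lt, hι', hι']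
          exact hι hj
        · simp only [Cube.codegeneracy, hι', hs]
        · refine hc y y' _ ?_
          rintro ⟨j, hj⟩
          exact hk ⟨j, Fin.succAbove_right_injective (by rw [hι', hj])⟩
      have : s = fun y => Cube.coface a (s (fun _ => false) a) (Cube.codegeneracy a (s y)) := by
        funext y
        rw [hc _ y a ha, coface_codegeneracy]
      rw [this]
      exact hs'.comp (.coface a _)

/-- A box map none of whose coordinates is constant has a section through any prescribed family
of critical edges, one for each output coordinate. -/
theorem exists_section {n m : ℕ} {f : Cube n → Cube m} (hf : IsBoxMap f)
    (u : Fin m → Cube n) (i : Fin m → Fin n)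
    (h0 : ∀ j, f (Function.update (u j) (i j) false) j = false)
    (h1 : ∀ j, f (Function.update (u j) (i j) true) j = true) :
    ∃ s : Cube m → Cube n, IsBoxMap s ∧ (∀ y, f (s y) = y) ∧
      (∀ y j a, Dep f j a → s y a = Function.update (u j) (i j) (y j) a) ∧
      (∀ y j b, s (Function.update y j b) = Function.update (s y) (i j) b) := by
  classical
  have hdep : ∀ j, Dep f j (i j) := by
    intro j
    refine ⟨Function.update (u j) (i j) false, true, ?_⟩
    rw [Function.update_idem, h1, h0]
    simp
  have hι : StrictMono i := by
    intro j j' hj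
    by_contra hle
    exact absurd (hf.le_of_dep (hdep j') (hdep j) (not_lt.1 hle)) (not_le.2 hj)
  have huniq : ∀ {j j' a}, Dep f j a → Dep f j' a → j = j' := fun h h' =>
    le_antisymm (hf.le_of_dep h h' le_rfl) (hf.le_of_dep h' h le_rfl)
  let s : Cube m → Cube n := fun y a =>
    if h : ∃ j, Dep f j a then Function.update (u h.choose) (i h.choose) (y h.choose) a else false
  have hs : ∀ y j a, Dep f j a → s y a = Function.update (u j) (i j) (y j) a := by
    intro y j a hj
    have hex : ∃ j, Dep f j a := ⟨j, hj⟩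
    have : hex.choose = j := huniq hex.choose_spec hj
    change (if h : ∃ j, Dep f j a then _ else _) = _
    rw [dif_pos hex, this]
  have hsi : ∀ y j, s y (i j) = y j := fun y j => by
    rw [hs y j _ (hdep j), Function.update_self]
  have hsc : ∀ y y' a, a ∉ Set.range i → s y a = s y' a := by
    intro y y' a ha
    by_cases hex : ∃ j, Dep f j a
    · obtain ⟨j, hj⟩ := hex
      have hne : a ≠ i j := fun e => ha ⟨j, e.symm⟩
      rw [hs y j a hj, hs y' j a hj, Function.update_of_ne hne, Function.update_of_ne hne]
    · change (if h : ∃ j, Dep f j a then _ else _) = (if h : ∃ j, Dep f j a then _ else _)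
      rw [dif_neg hex, dif_neg hex]
  refine ⟨s, of_strictMono i hι s hsi hsc, fun y => funext fun j => ?_, hs, fun y j b => ?_⟩
  · rw [eq_of_forall_dep (hs y j)]
    cases y j
    · exact h0 j
    · exact h1 j
  · funext a
    by_cases ha : a ∈ Set.range i
    · obtain ⟨j', rfl⟩ := ha
      rw [hsi]
      by_cases hj : j' = j
      · subst hj; simp
      · rw [Function.update_of_ne hj, Function.update_of_ne (hι.injective.ne hj), hsi]
    · rw [Function.update_of_ne (fun e => ha ⟨j, e.symm⟩)]
      exact hsc _ _ a ha

theorem exists_critical_edges {n m : ℕ} {f : Cube n → Cube m} (hf : IsBoxMap f)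
    (h : Nonconst f) :
    ∃ (u : Fin m → Cube n) (i : Fin m → Fin n),
      ∀ j, f (Function.update (u j) (i j) false) j = false ∧
        f (Function.update (u j) (i j) true) j = true := by
  have : ∀ j, ∃ (u : Cube n) (i : Fin n), f (Function.update u i false) j = false ∧
      f (Function.update u i true) j = true := by
    intro j
    obtain ⟨v, hv⟩ : ∃ v, f v j = true := by
      obtain ⟨x, y, hxy⟩ := h j
      cases hx : f x j
      · exact ⟨y, by rw [hx] at hxy; simpa using hxy.symm⟩
      · exact ⟨x, hx⟩
    obtain ⟨u, i, h0, h1, -⟩ := hf.exists_critical_edge h hv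
    exact ⟨u, i, h0, h1⟩
  choose u i hui using this
  exact ⟨u, i, hui⟩

theorem exists_section_of_nonconst {n m : ℕ} {f : Cube n → Cube m} (hf : IsBoxMap f)
    (h : Nonconst f) : ∃ s : Cube m → Cube n, IsBoxMap s ∧ ∀ y, f (s y) = y := by
  obtain ⟨u, i, hui⟩ := hf.exists_critical_edges h
  obtain ⟨s, hs, hfs, -⟩ := hf.exists_section u i (fun j => (hui j).1) (fun j => (hui j).2)
  exact ⟨s, hs, hfs⟩

/-- The variant of `exists_section` with only one of the critical edges prescribed, in direction `a`
through `v`. -/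
theorem exists_section_through {n m : ℕ} {f : Cube n → Cube m} (hf : IsBoxMap f)
    (h : Nonconst f) {j : Fin m} {v : Cube n} {a : Fin n}
    (h0 : f (Function.update v a false) j = false) (h1 : f (Function.update v a true) j = true) :
    ∃ s : Cube m → Cube n, IsBoxMap s ∧ (∀ y, f (s y) = y) ∧
      (∀ y b, Dep f j b → s y b = Function.update v a (y j) b) ∧
      (∀ y b, s (Function.update y j b) = Function.update (s y) a b) := by
  obtain ⟨u, i, hui⟩ := hf.exists_critical_edges h
  have key : ∀ l, f (Function.update (Function.update u j v l) (Function.update i j a l) false) l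
      = false ∧ f (Function.update (Function.update u j v l) (Function.update i j a l) true) l
      = true := by
    intro l
    by_cases hl : l = j
    · subst hl; simp [h0, h1]
    · simp only [Function.update_of_ne hl]; exact hui l
  obtain ⟨s, hs, hfs, h2, h3⟩ :=
    hf.exists_section _ _ (fun l => (key l).1) (fun l => (key l).2)
  refine ⟨s, hs, hfs, fun y b hb => ?_, fun y b => ?_⟩
  · simpa using h2 y j b hb
  · simpa using h3 y j b

/-- The sections of `f` detect on which input coordinates it depends: such a coordinate is the direction
of a critical edge, hence is moved by some section. -/
theorem dep_of_sections {n m : ℕ} {f g : Cube n → Cube m} (hf : IsBoxMap f) (h : Nonconst f)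
    (hfg : ∀ s, IsBoxMap s → (∀ y, f (s y) = y) → ∀ y, g (s y) = y) {j : Fin m} {a : Fin n}
    (hd : Dep f j a) : Dep g j a := by
  obtain ⟨x, b, hx⟩ := hd
  have hmono : f (Function.update x a false) j ≤ f (Function.update x a true) j :=
    hf.monotone (by
      intro c
      by_cases hc : c = a
      · subst hc; simp
      · simp [Function.update_of_ne hc]) j
  have hne : f (Function.update x a false) j ≠ f (Function.update x a true) j := by
    intro e
    refine hx ?_
    have hx' : f x j = f (Function.update x a (x a)) j := by rw [Function.update_eq_self]
    rw [hx']
    cases b <;> cases x a <;> simp [e]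
  have h01 : f (Function.update x a false) j = false ∧ f (Function.update x a true) j = true := by
    revert hmono hne
    cases f (Function.update x a false) j <;> cases f (Function.update x a true) j <;> simp
  obtain ⟨s, hs, hfs, -, hsu⟩ := hf.exists_section_through h h01.1 h01.2
  have hgs := hfg s hs hfs
  refine ⟨s (fun _ => false), true, ?_⟩
  rw [← hsu, hgs, hgs]
  simp

/-- One half of `eq_of_sections`. If `f v j` is true, a section through a critical edge of `f`
below `v` shows that `g v j` is true. -/
theorem le_of_sections {n m : ℕ} {f g : Cube n → Cube m} (hf : IsBoxMap f) (hg : IsBoxMap g)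
    (h : Nonconst f) (h' : Nonconst g)
    (hfg : ∀ s, IsBoxMap s → (∀ y, f (s y) = y) → ∀ y, g (s y) = y)
    (hgf : ∀ s, IsBoxMap s → (∀ y, g (s y) = y) → ∀ y, f (s y) = y) (v : Cube n) (j : Fin m) :
    f v j ≤ g v j := by
  classical
  cases hv : f v j
  · exact Bool.false_le _
  obtain ⟨u, a, h0, h1, hle⟩ := hf.exists_critical_edge h hv
  obtain ⟨s, hs, hfs, hsu, -⟩ := hf.exists_section_through h h0 h1
  -- the section stays below `v` in all the coordinates on which the `j`-th output depends
  let y : Cube m := fun _ => true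
  let z : Cube n := fun b => if Dep g j b then s y b else v b
  have hz : z ≤ v := by
    intro b
    change (if Dep g j b then s y b else v b) ≤ v b
    split_ifs with hb
    · rw [hsu y b (hg.dep_of_sections h' hgf hb)]
      exact hle b
    · exact le_rfl
  have hgz : g z j = true := by
    refine Eq.trans (eq_of_forall_dep fun b hb => ?_) (congrFun (hfg s hs hfs y) j)
    change (if Dep g j b then s y b else v b) = _
    rw [if_pos hb]
  rw [← hgz]
  exact hg.monotone hz j

/-- A box map none of whose coordinates is constant is determined by its sections. -/
theorem eq_of_sections {n m : ℕ} {f g : Cube n → Cube m} (hf : IsBoxMap f) (hg : IsBoxMap g)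
    (h : Nonconst f) (h' : Nonconst g)
    (hfg : ∀ s, IsBoxMap s → (∀ y, f (s y) = y) → ∀ y, g (s y) = y)
    (hgf : ∀ s, IsBoxMap s → (∀ y, g (s y) = y) → ∀ y, f (s y) = y) : f = g :=
  funext fun v => funext fun j => le_antisymm (hf.le_of_sections hg h h' hfg hgf v j)
    (hg.le_of_sections hf h' h hgf hfg v j)

/-- An endomorphism of a cube none of whose coordinates is constant is the identity. -/
theorem eq_id_of_nonconst {n : ℕ} {f : Cube n → Cube n} (hf : IsBoxMap f) (h : Nonconst f)
    (x : Cube n) : f x = x := by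
  obtain ⟨u, i, hui⟩ := hf.exists_critical_edges h
  have hdep : ∀ j, Dep f j (i j) := fun j =>
    ⟨Function.update (u j) (i j) false, true, by
      rw [Function.update_idem, (hui j).1, (hui j).2]; simp⟩
  have hι : StrictMono i := by
    intro j j' hj
    by_contra hle
    exact absurd (hf.le_of_dep (hdep j') (hdep j) (not_lt.1 hle)) (not_le.2 hj)
  -- a strictly increasing choice of input coordinates must be the identity
  have hid : i = fun j => j := by
    let e : Fin n ≃o Fin n := hι.orderIsoOfSurjective i (Finite.surjective_of_injective hι.injective)
    have : e = OrderIso.refl _ := Subsingleton.elim _ _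
    funext j
    exact congrArg (fun e : Fin n ≃o Fin n => e j) this
  subst hid
  have huniq : ∀ {j a}, Dep f j a → j = a := fun {j a} hj =>
    le_antisymm (hf.le_of_dep hj (hdep a) le_rfl) (hf.le_of_dep (hdep a) hj le_rfl)
  funext j
  have : f x j = f (Function.update (u j) j (x j)) j :=
    eq_of_forall_dep fun a ha => by rw [← huniq ha, Function.update_self]
  rw [this]
  cases x j
  · exact (hui j).1
  · exact (hui j).2

end IsBoxMap

namespace Box

theorem hom_ext_apply {m n : ℕ} {f g : (⟨m⟩ : Box) ⟶ ⟨n⟩} (h : ∀ x, f.toFun x = g.toFun x) :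
    f = g := Box.Hom.ext (funext h)

theorem exists_eq_comp_coface {m n : ℕ} (σ : (⟨m⟩ : Box) ⟶ ⟨n + 1⟩) (j : Fin (n + 1)) (δ : Bool)
    (h : ∀ x, σ.toFun x j = δ) : ∃ τ : (⟨m⟩ : Box) ⟶ ⟨n⟩, σ = τ ≫ coface j δ := by
  refine ⟨⟨fun x => Cube.codegeneracy j (σ.toFun x), σ.isBoxMap.comp (.codegeneracy j)⟩,
    hom_ext_apply fun x => ?_⟩
  change _ = Cube.coface j δ (Cube.codegeneracy j (σ.toFun x))
  rw [← h x, Cube.coface_codegeneracy]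

theorem coface_injective {m n : ℕ} {a b : (⟨m⟩ : Box) ⟶ ⟨n⟩} {j : Fin (n + 1)} {δ δ' : Bool}
    (h : a ≫ coface j δ = b ≫ coface j δ') : δ = δ' ∧ a = b := by
  have h' : ∀ x, Cube.coface j δ (a.toFun x) = Cube.coface j δ' (b.toFun x) :=
    fun x => congrFun (congrArg Box.Hom.toFun h) x
  refine ⟨?_, hom_ext_apply fun x => ?_⟩
  · simpa using congrFun (h' fun _ => false) j
  · simpa using congrArg (Cube.codegeneracy j) (h' x)

theorem coface_comp_coface {n : ℕ} {j j' : Fin (n + 2)} {p q : Fin (n + 1)} (δ δ' : Bool)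
    (hp : j.succAbove p = j') (hq : j'.succAbove q = j) :
    coface p δ' ≫ coface j δ = coface q δ ≫ coface j' δ' := by
  have hinj : ∀ k : Fin n, j.succAbove (p.succAbove k) = j'.succAbove (q.succAbove k) := by
    intro k
    have hq' : q = p.predAbove j := by
      apply Fin.succAbove_right_injective (p := j')
      rw [hq, ← hp, Fin.succAbove_succAbove_predAbove]
    rw [hq', ← hp, Fin.succAbove_succAbove_succAbove_predAbove]
  refine hom_ext_apply fun x => ?_
  change Cube.coface j δ (Cube.coface p δ' x) = Cube.coface j' δ' (Cube.coface q δ x)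
  funext l
  by_cases hl : l = j
  · subst hl
    rw [Cube.coface_same]
    conv_rhs => rw [← hq]
    simp
  · obtain ⟨k, rfl⟩ := Fin.exists_succAbove_eq hl
    by_cases hk : k = p
    · subst hk
      rw [hp]; simp [← hp]
    · obtain ⟨k, rfl⟩ := Fin.exists_succAbove_eq hk
      rw [Cube.coface_succAbove, Cube.coface_succAbove, hinj, Cube.coface_succAbove,
        Cube.coface_succAbove]

/-- Two different faces of a cube meet in a common face of both. -/
theorem exists_common_face {m n : ℕ} {a b : (⟨m⟩ : Box) ⟶ ⟨n + 1⟩} {j j' : Fin (n + 2)}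
    {p q : Fin (n + 1)} {δ δ' : Bool} (hp : j.succAbove p = j') (hq : j'.succAbove q = j)
    (h : a ≫ coface j δ = b ≫ coface j' δ') :
    ∃ c : (⟨m⟩ : Box) ⟶ ⟨n⟩, a = c ≫ coface p δ' ∧ b = c ≫ coface q δ := by
  obtain ⟨c, rfl⟩ := exists_eq_comp_coface a p δ' fun x => by
    have h' : Cube.coface j δ (a.toFun x) = Cube.coface j' δ' (b.toFun x) :=
      congrFun (congrArg Box.Hom.toFun h) x
    rw [← Cube.coface_succAbove j δ (a.toFun x) p, h', hp, Cube.coface_same]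
  refine ⟨c, rfl, ?_⟩
  rw [Category.assoc, coface_comp_coface δ δ' hp hq, ← Category.assoc] at h
  exact (coface_injective h).2.symm

end Box

/-! ### Cubes of cubical sets -/

namespace CSet

/-- The `n`-cubes of a cubical set. -/
abbrev cell (X : CSet.{u}) (n : ℕ) : Type u := X.obj (op ⟨n⟩)

/-- The right action of the box category on the cubes of a cubical set. -/
def res {X : CSet.{u}} {m n : ℕ} (x : X.cell n) (σ : (⟨m⟩ : Box) ⟶ ⟨n⟩) : X.cell m :=
  X.map σ.op x

infixl:80 " ◃ " => CSet.res

/-- The value of a map of cubical sets at a cube. -/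
def ev {X Y : CSet.{u}} (f : X ⟶ Y) {n : ℕ} (x : X.cell n) : Y.cell n := f.app (op ⟨n⟩) x

section

variable {X Y Z : CSet.{u}} {k m n : ℕ}

theorem res_comp (x : X.cell n) (σ : (⟨m⟩ : Box) ⟶ ⟨n⟩) (τ : (⟨k⟩ : Box) ⟶ ⟨m⟩) :
    x ◃ (τ ≫ σ) = x ◃ σ ◃ τ := by
  simp [res]

@[simp] theorem res_id (x : X.cell n) : x ◃ 𝟙 _ = x := by
  simp [res]

theorem ev_res (f : X ⟶ Y) (x : X.cell n) (σ : (⟨m⟩ : Box) ⟶ ⟨n⟩) :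
    ev f (x ◃ σ) = ev f x ◃ σ :=
  ConcreteCategory.congr_hom (f.naturality σ.op) x

@[simp] theorem ev_comp (f : X ⟶ Y) (g : Y ⟶ Z) (x : X.cell n) : ev (f ≫ g) x = ev g (ev f x) :=
  rfl

@[simp] theorem ev_id (x : X.cell n) : ev (𝟙 X) x = x := rfl

theorem hom_ext_cell {f g : X ⟶ Y} (h : ∀ n (x : X.cell n), ev f x = ev g x) : f = g := by
  refine NatTrans.ext (funext fun a => ?_)
  ext x
  exact h a.unop.dim x

/-- A map of cubical sets, given by its values at the cubes. -/
def homMk (F : ∀ n, X.cell n → Y.cell n)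
    (hF : ∀ {m n} (x : X.cell n) (σ : (⟨m⟩ : Box) ⟶ ⟨n⟩), F m (x ◃ σ) = F n x ◃ σ) : X ⟶ Y where
  app a := TypeCat.ofHom fun x => F a.unop.dim x
  naturality a b σ := by
    ext x
    exact hF (m := b.unop.dim) (n := a.unop.dim) x σ.unop

@[simp] theorem ev_homMk (F : ∀ n, X.cell n → Y.cell n)
    (hF : ∀ {m n} (x : X.cell n) (σ : (⟨m⟩ : Box) ⟶ ⟨n⟩), F m (x ◃ σ) = F n x ◃ σ)
    (x : X.cell n) : ev (homMk F hF) x = F n x := rfl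

end

/-! ### Correspondences and lifting problems -/

/-- A correspondence between cubical sets, that is, a cubical subset of `Y × E`. A cube `e` of `E`
related to `y` is regarded as lying over `y`; this encodes a map to `Y` with varying total space,
and maps `Y ⟶ E` with graph in the correspondence are its sections. -/
structure Corr (Y E : CSet.{u}) where
  rel : ∀ {n : ℕ}, Y.cell n → E.cell n → Prop
  res : ∀ {m n : ℕ} {y : Y.cell n} {e : E.cell n} (σ : (⟨m⟩ : Box) ⟶ ⟨n⟩), rel y e →
    rel (y ◃ σ) (e ◃ σ)

/-- The compatibility of a family of `n`-cubes, indexed by a set `A` of faces of the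
`n+1`-cube: it defines a map on the union of these faces. -/
def FaceCompatible (E : CSet.{u}) {n : ℕ} (A : Set (Fin (n + 1) × Bool))
    (e : Fin (n + 1) → Bool → E.cell n) : Prop :=
  ∀ j δ j' δ', (j, δ) ∈ A → (j', δ') ∈ A → ∀ (m : ℕ) (a b : (⟨m⟩ : Box) ⟶ ⟨n⟩),
    a ≫ Box.coface j δ = b ≫ Box.coface j' δ' → e j δ ◃ a = e j' δ' ◃ b

namespace Corr

variable {Y E : CSet.{u}}

instance : Preorder (Corr Y E) where
  le Γ Γ' := ∀ ⦃n : ℕ⦄ ⦃y : Y.cell n⦄ ⦃e : E.cell n⦄, Γ.rel y e → Γ'.rel y e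
  le_refl _ _ _ _ h := h
  le_trans _ _ _ h h' _ _ _ hr := h' (h hr)

/-- The cubes over which there is a cube. -/
def Dom (Γ : Corr Y E) {n : ℕ} (y : Y.cell n) : Prop := ∃ e, Γ.rel y e

theorem Dom.res {Γ : Corr Y E} {m n : ℕ} {y : Y.cell n} (h : Γ.Dom y)
    (σ : (⟨m⟩ : Box) ⟶ ⟨n⟩) : Γ.Dom (y ◃ σ) :=
  let ⟨_, he⟩ := h
  ⟨_, Γ.res σ he⟩

/-- A correspondence is functional if it is the graph of a map defined on a cubical subset. -/
def Functional (Γ : Corr Y E) : Prop :=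
  ∀ ⦃n : ℕ⦄ ⦃y : Y.cell n⦄ ⦃e e' : E.cell n⦄, Γ.rel y e → Γ.rel y e' → e = e'

theorem exists_hom_of_total {Γ : Corr Y E} (hΓ : Γ.Functional)
    (h : ∀ (n : ℕ) (y : Y.cell n), Γ.Dom y) :
    ∃ f : Y ⟶ E, ∀ (n : ℕ) (y : Y.cell n), Γ.rel y (ev f y) := by
  choose F hF using h
  exact ⟨homMk F fun y σ => hΓ (hF _ _) (Γ.res σ (hF _ _)), hF⟩

/-- The total correspondence. -/
def univ (Y E : CSet.{u}) : Corr Y E := ⟨fun _ _ => True, fun _ _ => trivial⟩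

/-- The union of a nonempty family of correspondences. -/
def sUnion (c : Set (Corr Y E)) : Corr Y E where
  rel y e := ∃ Γ ∈ c, Γ.rel y e
  res σ := fun ⟨Γ, hΓ, h⟩ => ⟨Γ, hΓ, Γ.res σ h⟩

theorem Functional.sUnion {c : Set (Corr Y E)} (hc : IsChain (· ≤ ·) c)
    (h : ∀ Γ ∈ c, Γ.Functional) : (Corr.sUnion c).Functional := by
  rintro n y e e' ⟨Γ, hΓ, he⟩ ⟨Γ', hΓ', he'⟩
  rcases hc.total hΓ hΓ' with hle | hle
  · exact h Γ' hΓ' (hle he) he'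
  · exact h Γ hΓ he (hle he')

/-- The lifting property of a correspondence against the boundary inclusions of the cubes. -/
structure BoundaryFilling (R : Corr Y E) : Prop where
  zero : ∀ y : Y.cell 0, R.Dom y
  succ : ∀ {n : ℕ} (y : Y.cell (n + 1)) (e : Fin (n + 1) → Bool → E.cell n),
    FaceCompatible E Set.univ e → (∀ j δ, R.rel (y ◃ Box.coface j δ) (e j δ)) →
    ∃ w, R.rel y w ∧ ∀ j δ, w ◃ Box.coface j δ = e j δ

/-- The lifting property of a correspondence against the open box inclusions. -/
def KanFilling (R : Corr Y E) : Prop :=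
  ∀ (n : ℕ) (i : Fin (n + 1)) (ε : Bool) (y : Y.cell (n + 1))
    (e : Fin (n + 1) → Bool → E.cell n),
    FaceCompatible E {(i, ε)}ᶜ e →
    (∀ j δ, (j, δ) ≠ (i, ε) → R.rel (y ◃ Box.coface j δ) (e j δ)) →
    ∃ w, R.rel y w ∧ ∀ j δ, (j, δ) ≠ (i, ε) → w ◃ Box.coface j δ = e j δ

/-- The one-step extension of a section: a cube `y` of minimal dimension outside the
domain of `Γ` is adjoined to the domain. That the new section is well defined is the
Eilenberg–Zilber property of the box category. -/
theorem Functional.exists_extension_cube {Γ R : Corr Y E} (hR : R.BoundaryFilling)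
    (hΓ : Γ.Functional) (hΓR : Γ ≤ R) {n : ℕ} {y : Y.cell n} (hy : ¬ Γ.Dom y)
    (hmin : ∀ k < n, ∀ z : Y.cell k, Γ.Dom z) :
    ∃ Γ' : Corr Y E, Γ ≤ Γ' ∧ Γ'.Functional ∧ Γ' ≤ R ∧ Γ'.Dom y := by
  -- a value at `y` compatible with those on the boundary of `y`
  obtain ⟨e, hye, hbd⟩ : ∃ e, R.rel y e ∧ ∀ {m : ℕ} (σ : (⟨m⟩ : Box) ⟶ ⟨n⟩),
      ¬ Cube.Nonconst σ.toFun → Γ.rel (y ◃ σ) (e ◃ σ) := by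
    cases n with
    | zero =>
      obtain ⟨e, he⟩ := hR.zero y
      exact ⟨e, he, fun σ hσ => absurd (fun j => j.elim0) hσ⟩
    | succ n =>
      choose e he using fun j δ => hmin n (Nat.lt_succ_self n) (y ◃ Box.coface j δ)
      obtain ⟨w, hw, hwe⟩ := hR.succ y e
        (fun j δ j' δ' _ _ m a b hab => by
          have h1 := Γ.res a (he j δ)
          have h2 := Γ.res b (he j' δ')
          rw [← res_comp, hab, res_comp] at h1
          exact hΓ h1 h2)
        (fun j δ => hΓR (he j δ))
      refine ⟨w, hw, fun {m} σ hσ => ?_⟩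
      unfold Cube.Nonconst at hσ
      push Not at hσ
      obtain ⟨j, hj⟩ := hσ
      obtain ⟨δ, hδ⟩ : ∃ δ, ∀ x, σ.toFun x j = δ := ⟨_, fun x => hj x (fun _ => false)⟩
      obtain ⟨τ, rfl⟩ := Box.exists_eq_comp_coface σ j δ hδ
      rw [res_comp, res_comp, hwe]
      exact Γ.res τ (he _ _)
  have hdeg : ∀ {m : ℕ} (σ : (⟨m⟩ : Box) ⟶ ⟨n⟩), ¬ Cube.Nonconst σ.toFun → Γ.Dom (y ◃ σ) :=
    fun σ hσ => ⟨_, hbd σ hσ⟩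
  -- the cubes `y ◃ σ` with `σ` nonconstant are new
  have hnew : ∀ {m : ℕ} (σ : (⟨m⟩ : Box) ⟶ ⟨n⟩), Γ.Dom (y ◃ σ) → ¬ Cube.Nonconst σ.toFun := by
    intro m σ hσ hnc
    obtain ⟨s, hs, hsσ⟩ := σ.isBoxMap.exists_section_of_nonconst hnc
    have h := hσ.res (⟨s, hs⟩ : (⟨n⟩ : Box) ⟶ ⟨m⟩)
    rw [← res_comp, show (⟨s, hs⟩ : (⟨n⟩ : Box) ⟶ ⟨m⟩) ≫ σ = 𝟙 _ from Box.hom_ext_apply hsσ,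
      res_id] at h
    exact hy h
  have hsec : ∀ {m : ℕ} (σ τ : (⟨m⟩ : Box) ⟶ ⟨n⟩), y ◃ σ = y ◃ τ →
      ∀ s, IsBoxMap s → (∀ x, σ.toFun (s x) = x) → ∀ x, τ.toFun (s x) = x := by
    intro m σ τ h s hs hσ
    let s' : (⟨n⟩ : Box) ⟶ ⟨m⟩ := ⟨s, hs⟩
    refine IsBoxMap.eq_id_of_nonconst (hs.comp τ.isBoxMap) ?_
    by_contra hnc
    have h1 : Γ.Dom (y ◃ (s' ≫ τ)) := hdeg (s' ≫ τ) hnc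
    rw [res_comp, ← h, ← res_comp, show s' ≫ σ = 𝟙 _ from Box.hom_ext_apply hσ, res_id] at h1
    exact hy h1
  refine ⟨⟨fun {m} z w => Γ.rel z w ∨ ∃ σ : (⟨m⟩ : Box) ⟶ ⟨n⟩, z = y ◃ σ ∧ w = e ◃ σ, ?_⟩,
    fun _ _ _ h => Or.inl h, ?_, ?_, e, Or.inr ⟨𝟙 _, by simp, by simp⟩⟩
  · rintro k m z w τ (h | ⟨σ, rfl, rfl⟩)
    · exact Or.inl (Γ.res τ h)
    · exact Or.inr ⟨τ ≫ σ, (res_comp _ _ _).symm, (res_comp _ _ _).symm⟩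
  · have hmix : ∀ {m : ℕ} {w : E.cell m} (σ : (⟨m⟩ : Box) ⟶ ⟨n⟩), Γ.rel (y ◃ σ) w →
        w = e ◃ σ := fun σ hw => hΓ hw (hbd σ (hnew σ ⟨_, hw⟩))
    rintro m z w w' (h | ⟨σ, rfl, rfl⟩) (h' | ⟨τ, hz, rfl⟩)
    · exact hΓ h h'
    · subst hz; exact hmix τ h
    · exact (hmix σ h').symm
    · by_cases hσ : Γ.Dom (y ◃ σ)
      · obtain ⟨w, hw⟩ := hσ
        rw [← hmix σ hw]
        rw [hz] at hw
        exact hmix τ hw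
      · have hσ' : Cube.Nonconst σ.toFun := by
          by_contra hnc; exact hσ (hdeg σ hnc)
        have hτ' : Cube.Nonconst τ.toFun := by
          by_contra hnc; exact hσ (hz ▸ hdeg τ hnc)
        have : σ = τ := Box.Hom.ext (σ.isBoxMap.eq_of_sections τ.isBoxMap hσ' hτ'
          (hsec σ τ hz) (hsec τ σ hz.symm))
        rw [this]
  · rintro m z w (h | ⟨σ, rfl, rfl⟩)
    · exact hΓR h
    · exact R.res σ hye

/-- A section of a correspondence with the lifting property against boundary
inclusions extends from any cubical subset, i.e. the lifting property holds against all
monomorphisms. -/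
theorem BoundaryFilling.exists_extension {R : Corr Y E} (hR : R.BoundaryFilling) {Γ : Corr Y E}
    (hΓ : Γ.Functional) (hΓR : Γ ≤ R) :
    ∃ f : Y ⟶ E, (∀ {n : ℕ} (y : Y.cell n), R.rel y (ev f y)) ∧
      ∀ {n : ℕ} {y : Y.cell n} {e : E.cell n}, Γ.rel y e → ev f y = e := by
  obtain ⟨M, hΓM, hM⟩ := zorn_le_nonempty₀ {Γ' : Corr Y E | Γ'.Functional ∧ Γ' ≤ R}
    (fun c hc hchain Γ₀ hΓ₀ => ⟨Corr.sUnion c,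
      ⟨Functional.sUnion hchain fun Γ' h => (hc h).1, fun _ _ _ ⟨Γ', h, hr⟩ => (hc h).2 hr⟩,
      fun Γ' h _ _ _ hr => ⟨Γ', h, hr⟩⟩) Γ ⟨hΓ, hΓR⟩
  have htot : ∀ (n : ℕ) (y : Y.cell n), M.Dom y := by
    intro n
    induction n using Nat.strong_induction_on with
    | _ n ih =>
      intro y
      by_contra hy
      obtain ⟨M', hle, hf, hR', hd⟩ := hM.prop.1.exists_extension_cube hR hM.prop.2 hy ih
      obtain ⟨e, he⟩ := hd
      exact hy ⟨e, hM.le_of_ge ⟨hf, hR'⟩ hle he⟩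
  obtain ⟨f, hf⟩ := exists_hom_of_total hM.prop.1 htot
  exact ⟨f, fun y => hM.prop.2 (hf _ y), fun h => hM.prop.1 (hf _ _) (hΓM h)⟩

end Corr

end CSet

/-! ### Paths and Kan complexes -/

namespace Box

/-- The codegeneracy map forgetting the last coordinate. -/
def degen (n : ℕ) : (⟨n + 1⟩ : Box) ⟶ ⟨n⟩ :=
  ⟨Cube.codegeneracy (Fin.last n), .codegeneracy _⟩

/-- The map `σ ⊗ [1]` of the box category, between cubes of explicit dimensions. -/
def tens {m n : ℕ} (σ : (⟨m⟩ : Box) ⟶ ⟨n⟩) : (⟨m + 1⟩ : Box) ⟶ ⟨n + 1⟩ :=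
  Box.tensorInterval.map σ

theorem tens_coface {n : ℕ} (j : Fin (n + 1)) (δ : Bool) :
    tens (coface j δ) = coface j.castSucc δ :=
  Box.Hom.ext (Cube.tensorInterval_coface j δ)

theorem tens_comp_degen {m n : ℕ} (σ : (⟨m⟩ : Box) ⟶ ⟨n⟩) :
    tens σ ≫ degen n = degen m ≫ σ := by
  refine hom_ext_apply fun x => ?_
  change Cube.codegeneracy (Fin.last n) (Cube.tensorInterval σ.toFun x) =
    σ.toFun (Cube.codegeneracy (Fin.last m) x)
  have h : ∀ {k : ℕ} (y : Cube (k + 1)), Cube.codegeneracy (Fin.last k) y = Fin.init y := by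
    intro k y; funext j; simp [Cube.codegeneracy, Fin.init]
  rw [h, h]
  simp [Cube.tensorInterval]

theorem coface_comp_degen (n : ℕ) (ε : Bool) : coface (Fin.last n) ε ≫ degen n = 𝟙 _ :=
  hom_ext_apply fun x => Cube.codegeneracy_coface _ ε x

end Box

namespace CSet

namespace path

variable {X Y E : CSet.{u}} {m n : ℕ}

/-- A path in `Y` of dimension `n`, regarded as a cube of dimension `n + 1`. -/
def cube (e : (path Y).cell n) : Y.cell (n + 1) := e

/-- A cube of dimension `n + 1`, regarded as a path of dimension `n`. -/
def ofCube (e : Y.cell (n + 1)) : (path Y).cell n := e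

@[simp] theorem cube_ofCube (e : Y.cell (n + 1)) : cube (ofCube e) = e := rfl

theorem cube_res (e : (path Y).cell n) (σ : (⟨m⟩ : Box) ⟶ ⟨n⟩) :
    cube (e ◃ σ) = cube e ◃ Box.tens σ := rfl

theorem ev_eval (e : (path Y).cell n) (ε : Bool) :
    ev (path.eval Y ε) e = cube e ◃ Box.coface (Fin.last n) ε := rfl

theorem cube_res_coface (e : (path Y).cell (n + 1)) (j : Fin (n + 1)) (δ : Bool) :
    cube (e ◃ Box.coface j δ) = cube e ◃ Box.coface j.castSucc δ := by
  rw [cube_res, Box.tens_coface]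

/-- The constant paths. -/
def const (Y : CSet.{u}) : Y ⟶ path Y :=
  homMk (fun n y => ofCube (y ◃ Box.degen n)) fun {m n} y σ => by
    change y ◃ σ ◃ Box.degen m = y ◃ Box.degen n ◃ Box.tens σ
    rw [← res_comp, ← res_comp, Box.tens_comp_degen]

theorem cube_const (y : Y.cell n) : cube (ev (const Y) y) = y ◃ Box.degen n := rfl

@[simp] theorem eval_const (y : Y.cell n) (ε : Bool) :
    ev (path.eval Y ε) (ev (const Y) y) = y := by
  rw [ev_eval, cube_const, ← res_comp, Box.coface_comp_degen, res_id]

/-- The functoriality of the cubical set of paths. -/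
def map (f : X ⟶ Y) : path X ⟶ path Y := Functor.whiskerLeft Box.tensorInterval.op f

/-- The family of faces of an `n+2`-cube, given by paths `e` in the directions other than the last
one, and by `z` in the last direction. -/
def faces (e : Fin (n + 1) → Bool → (path E).cell n) (z : Bool → E.cell (n + 1))
    (j : Fin (n + 2)) (δ : Bool) : E.cell (n + 1) :=
  Fin.lastCases (motive := fun _ => E.cell (n + 1)) (z δ) (fun j => cube (e j δ)) j

@[simp] theorem faces_last (e : Fin (n + 1) → Bool → (path E).cell n) (z : Bool → E.cell (n + 1))
    (δ : Bool) : faces e z (Fin.last _) δ = z δ := by simp [faces]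

@[simp] theorem faces_castSucc (e : Fin (n + 1) → Bool → (path E).cell n)
    (z : Bool → E.cell (n + 1)) (j : Fin (n + 1)) (δ : Bool) :
    faces e z j.castSucc δ = cube (e j δ) := by simp [faces]

end path

/-- A family of faces of an `n+2`-cube is compatible if the faces in the directions other than the last
one are compatible as paths, and their endpoints are the boundaries of the faces in the last
direction. -/
theorem FaceCompatible.faces {E : CSet.{u}} {n : ℕ} {A : Set (Fin (n + 1) × Bool)}
    {e : Fin (n + 1) → Bool → (path E).cell n} (he : FaceCompatible (path E) A e)
    {z : Bool → E.cell (n + 1)} {A' : Set (Fin (n + 2) × Bool)}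
    (hA : ∀ j δ, (Fin.castSucc j, δ) ∈ A' → (j, δ) ∈ A)
    (hz : ∀ j δ ε, (Fin.castSucc j, δ) ∈ A' → (Fin.last _, ε) ∈ A' →
      ev (path.eval E ε) (e j δ) = z ε ◃ Box.coface j δ) :
    FaceCompatible E A' (path.faces e z) := by
  have hlast : ∀ (j : Fin (n + 1)) (δ ε : Bool), (j.castSucc, δ) ∈ A' → (Fin.last _, ε) ∈ A' →
      ∀ (m : ℕ) (a b : (⟨m⟩ : Box) ⟶ ⟨n + 1⟩),
        a ≫ Box.coface j.castSucc δ = b ≫ Box.coface (Fin.last _) ε →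
        path.cube (e j δ) ◃ a = z ε ◃ b := by
    intro j δ ε h h' m a b hab
    have hp : j.castSucc.succAbove (Fin.last n) = Fin.last (n + 1) := by
      rw [Fin.succAbove_of_le_castSucc _ _ (by simpa using Fin.le_last j), Fin.succ_last]
    obtain ⟨c, rfl, rfl⟩ := Box.exists_common_face hp (Fin.succAbove_last_apply j) hab
    rw [res_comp, res_comp, ← hz j δ ε h h', path.ev_eval]
  intro j δ j' δ' h h' m a b hab
  by_cases hj : j = j'
  · subst hj
    obtain ⟨rfl, rfl⟩ := Box.coface_injective hab
    rfl
  induction j using Fin.lastCases with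
  | last =>
    induction j' using Fin.lastCases with
    | last => exact absurd rfl hj
    | cast j' =>
      simpa using (hlast j' δ' δ h' h m b a hab.symm).symm
  | cast j =>
    induction j' using Fin.lastCases with
    | last => simpa using hlast j δ δ' h h' m a b hab
    | cast j' =>
      have hj' : j ≠ j' := fun e => hj (congrArg _ e)
      obtain _ | n := n
      · exact absurd ((Fin.eq_zero j).trans (Fin.eq_zero j').symm) hj'
      obtain ⟨p, hp⟩ := Fin.exists_succAbove_eq hj'.symm
      obtain ⟨q, hq⟩ := Fin.exists_succAbove_eq hj'
      obtain ⟨c, rfl, rfl⟩ := Box.exists_common_face (p := p.castSucc) (q := q.castSucc)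
        (by rw [Fin.castSucc_succAbove_castSucc, hp])
        (by rw [Fin.castSucc_succAbove_castSucc, hq]) hab
      have key := congrArg path.cube (he j δ j' δ' (hA _ _ h) (hA _ _ h') _ _ _
        (Box.coface_comp_coface δ δ' hp hq))
      rw [path.cube_res_coface, path.cube_res_coface] at key
      rw [path.faces_castSucc, path.faces_castSucc, res_comp, res_comp, key]

/-- A Kan complex has the lifting property against open boxes, given as compatible families of
faces. -/
theorem IsKan.kanFilling_univ {K : CSet.{u}} (hK : IsKan K) (Y : CSet.{u}) :
    (Corr.univ Y K).KanFilling := by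
  intro n i ε _ e he _
  -- the map on the open box defined by the family of faces
  have hex : ∀ (m : ℕ) (x : CSet.cell (horn.{u} n i ε).toFunctor m), ∃ w : K.cell m,
      ∀ j δ (g : (⟨m⟩ : Box) ⟶ ⟨n⟩), (j, δ) ≠ (i, ε) → x.1.down = g ≫ Box.coface j δ →
        w = e j δ ◃ g := by
    rintro m ⟨x, j, δ, g, hne, hx⟩
    refine ⟨e j δ ◃ g, fun j' δ' g' hne' hx' => ?_⟩
    exact he j δ j' δ' hne hne' m g g' (hx.symm.trans hx')
  choose F hF using hex
  obtain ⟨g, hg⟩ := hK n i ε (homMk F (by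
    rintro m k ⟨x, j, δ, g, hne, hx⟩ σ
    rw [hF k ⟨x, j, δ, g, hne, hx⟩ j δ g hne hx, ← res_comp]
    refine hF m _ j δ (σ ≫ g) hne ?_
    change σ ≫ x.down = _
    rw [hx, Category.assoc]))
  let ι : (stdCube.{u} (n + 1)).cell (n + 1) := ULift.up (𝟙 _)
  refine ⟨ev g ι, trivial, fun j δ hne => ?_⟩
  have hmem : ι ◃ Box.coface j δ ∈ (horn.{u} n i ε).obj (op ⟨n⟩) :=
    ⟨j, δ, 𝟙 _, hne, by change Box.coface j δ ≫ 𝟙 _ = _; simp⟩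
  rw [← ev_res]
  have h1 : ev ((horn.{u} n i ε).ι ≫ g) (⟨_, hmem⟩ : CSet.cell (horn.{u} n i ε).toFunctor n) =
    e j δ := by
    rw [hg]
    exact (hF n _ j δ (𝟙 _) hne (by change Box.coface j δ ≫ 𝟙 _ = _; simp)).trans (res_id _)
  exact h1

namespace Corr

variable {Y Y' E : CSet.{u}}

/-- The paths in `E` lying over the paths given by `q` and having prescribed endpoints. -/
def pathEnds (R : Corr Y E) (q : Y' ⟶ path Y) (k : Bool → (Y' ⟶ E)) : Corr Y' (path E) where
  rel y e := R.rel (path.cube (ev q y)) (path.cube e) ∧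
    ∀ ε, ev (path.eval E ε) e = ev (k ε) y
  res σ h := by
    refine ⟨?_, fun ε => by rw [ev_res, ev_res, h.2]⟩
    rw [ev_res, path.cube_res, path.cube_res]
    exact R.res _ h.1

/-- The open box in a cube of paths, together with the two prescribed faces in the last direction,
is an open box of one dimension more. -/
theorem KanFilling.pathEnds {R : Corr Y E} (hR : R.KanFilling) (q : Y' ⟶ path Y)
    (k : Bool → (Y' ⟶ E))
    (hk : ∀ ε {n : ℕ} (y : Y'.cell n), R.rel (ev (path.eval Y ε) (ev q y)) (ev (k ε) y)) :
    (R.pathEnds q k).KanFilling := by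
  intro n i ε y e he hRe
  have hne : ∀ {j : Fin (n + 1)} {δ : Bool}, (j.castSucc, δ) ≠ (i.castSucc, ε) →
      (j, δ) ≠ (i, ε) := fun {j δ} h h' => h (by
    obtain ⟨rfl, rfl⟩ := Prod.mk.inj h'; rfl)
  have hne' : ∀ {j : Fin (n + 1)} {δ : Bool}, (j, δ) ≠ (i, ε) →
      (j.castSucc, δ) ≠ (i.castSucc, ε) := fun {j δ} h h' => h (by
    obtain ⟨h1, rfl⟩ := Prod.mk.inj h'
    rw [Fin.castSucc_inj.1 h1])
  have hl : ∀ δ, (Fin.last (n + 1), δ) ≠ (i.castSucc, ε) := fun δ h =>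
    (Fin.castSucc_lt_last i).ne' (Prod.mk.inj h).1
  obtain ⟨w, hw, hwe⟩ := hR _ i.castSucc ε (path.cube (ev q y))
    (path.faces e fun δ => ev (k δ) y)
    (he.faces (fun j δ h => hne h) (fun j δ ε' h _ => by
      rw [(hRe j δ (hne h)).2 ε', ev_res]))
    (fun j δ h => by
      induction j using Fin.lastCases with
      | last => rw [path.faces_last]; exact hk δ y
      | cast j =>
        rw [path.faces_castSucc, ← path.cube_res_coface, ← ev_res]
        exact (hRe j δ (hne h)).1)
  refine ⟨path.ofCube w, ⟨hw, fun δ => ?_⟩, fun j δ h => ?_⟩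
  · exact (hwe _ δ (hl δ)).trans (path.faces_last _ _ _)
  · have h1 := hwe _ δ (hne' h)
    rw [path.faces_castSucc] at h1
    have h2 := path.cube_res_coface (path.ofCube w) j δ
    exact h2.trans h1

/-- The paths in `E` lying over the paths given by `q` and having a prescribed source. -/
def pathFrom (R : Corr Y E) (q : Y' ⟶ path Y) (F : Y' ⟶ E) : Corr Y' (path E) where
  rel y e := R.rel (path.cube (ev q y)) (path.cube e) ∧ ev (path.eval E false) e = ev F y
  res σ h := by
    refine ⟨?_, by rw [ev_res, ev_res, h.2]⟩
    rw [ev_res, path.cube_res, path.cube_res]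
    exact R.res _ h.1

/-- The covering homotopy extension property: paths over a given path and with a given source
have the lifting property against boundary inclusions. Indeed the boundary of a cube of paths,
together with the face of sources, is an open box. -/
theorem KanFilling.pathFrom {R : Corr Y E} (hR : R.KanFilling) (q : Y' ⟶ path Y)
    (F : Y' ⟶ E)
    (hF : ∀ {n : ℕ} (y : Y'.cell n), R.rel (ev (path.eval Y false) (ev q y)) (ev F y)) :
    (R.pathFrom q F).BoundaryFilling where
  zero y := by
    obtain ⟨w, hw, hwe⟩ := hR _ (Fin.last 0) true (path.cube (ev q y)) (fun _ _ => ev F y)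
      (fun j δ j' δ' _ _ m a b hab => by
        obtain rfl : j = j' := (Fin.eq_zero j).trans (Fin.eq_zero j').symm
        rw [(Box.coface_injective hab).2])
      (fun j δ h => by
        obtain rfl : j = Fin.last 0 := Fin.eq_zero j
        obtain rfl : δ = false := by
          cases δ
          · rfl
          · exact absurd rfl h
        exact hF y)
    exact ⟨path.ofCube w, hw, hwe (Fin.last 0) false (by simp)⟩
  succ {n} y e he hRe := by
    have hl : ∀ (j : Fin (n + 1)) (δ : Bool), (j.castSucc, δ) ≠ (Fin.last (n + 1), true) :=
      fun j δ h => (Fin.castSucc_lt_last j).ne (Prod.mk.inj h).1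
    have hl' : ∀ {δ : Bool}, (Fin.last (n + 1), δ) ≠ (Fin.last (n + 1), true) → δ = false := by
      intro δ h
      cases δ
      · rfl
      · exact absurd rfl h
    obtain ⟨w, hw, hwe⟩ := hR _ (Fin.last (n + 1)) true (path.cube (ev q y))
      (path.faces e fun _ => ev F y)
      (he.faces (fun _ _ _ => Set.mem_univ _) (fun j δ ε _ h => by
        rw [hl' h, (hRe j δ).2, ev_res]))
      (fun j δ h => by
        induction j using Fin.lastCases with
        | last => rw [path.faces_last, hl' h]; exact hF y
        | cast j =>
          rw [path.faces_castSucc, ← path.cube_res_coface, ← ev_res]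
          exact (hRe j δ).1)
    refine ⟨path.ofCube w, ⟨hw, ?_⟩, fun j δ => ?_⟩
    · exact (hwe _ false (by simp)).trans (path.faces_last _ _ _)
    · have h1 := hwe _ δ (hl j δ)
      rw [path.faces_castSucc] at h1
      exact (path.cube_res_coface (path.ofCube w) j δ).trans h1

/-- The inverse image of a correspondence under a map of the base. -/
def pullback (R : Corr Y E) (f : Y' ⟶ Y) : Corr Y' E where
  rel y e := R.rel (ev f y) e
  res σ h := by rw [ev_res]; exact R.res σ h

theorem KanFilling.pullback {R : Corr Y E} (hR : R.KanFilling) (f : Y' ⟶ Y) :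
    (R.pullback f).KanFilling := by
  intro n i ε y e he hRe
  refine hR n i ε (ev f y) e he fun j δ h => ?_
  rw [← ev_res]
  exact hRe j δ h

/-- The empty correspondence. -/
def empty (Y E : CSet.{u}) : Corr Y E := ⟨fun _ _ => False, fun _ h => h⟩

end Corr

/-! ### Homotopy of maps into a Kan complex -/

theorem ElementaryHomotopic.refl {X K : CSet.{u}} (f : X ⟶ K) : ElementaryHomotopic f f :=
  ⟨f ≫ path.const K, hom_ext_cell fun _ _ => by simp, hom_ext_cell fun _ _ => by simp⟩

/-- The source of a homotopy into a Kan complex can be moved along another homotopy. -/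
theorem ElementaryHomotopic.move_source {X K : CSet.{u}} (hK : IsKan K) {f g k : X ⟶ K}
    (hfg : ElementaryHomotopic f g) (hfk : ElementaryHomotopic f k) :
    ElementaryHomotopic k g := by
  obtain ⟨h, rfl, rfl⟩ := hfg
  obtain ⟨h', hh', rfl⟩ := hfk
  -- the paths in `K`, as a correspondence over the pairs of endpoints
  let K₂ := FunctorToTypes.prod K K
  let k : Bool → (K₂ ⟶ K) := fun ε => if ε then FunctorToTypes.prod.snd else FunctorToTypes.prod.fst
  let R : Corr K₂ (path K) := (Corr.univ K₂ K).pathEnds (path.const K₂) k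
  have hR : R.KanFilling := (hK.kanFilling_univ K₂).pathEnds _ _ fun _ _ _ => trivial
  -- the source moves along `h'` and the target is constant
  let q : X ⟶ path K₂ := homMk
    (fun n x => path.ofCube (Y := K₂) (n := n) (path.cube (ev h' x),
      path.cube (ev (path.const K) (ev (path.eval K true) (ev h x)))))
    (fun {m n} x σ => by
      rw [ev_res, ev_res, ev_res, ev_res, path.cube_res, path.cube_res]
      rfl)
  have hsrc : ∀ {n : ℕ} (x : X.cell n), ev (path.eval K false) (ev h' x) =
      ev (path.eval K false) (ev h x) := fun x => by rw [← ev_comp, hh', ev_comp]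
  obtain ⟨D, hD, -⟩ := (hR.pathFrom q h fun {n} x => ⟨trivial, fun ε => by
    cases ε
    · exact (hsrc x).symm
    · exact (path.eval_const (ev (path.eval K true) (ev h x)) false).symm⟩).exists_extension
      (Γ := Corr.empty _ _) (fun _ _ _ _ h => h.elim) (fun _ _ _ h => h.elim)
  have hend : ∀ {n : ℕ} (x : X.cell n), R.rel (ev (path.eval K₂ true) (ev q x))
      (ev (path.eval (path K) true) (ev D x)) := fun x => R.res _ (hD x).1
  refine ⟨D ≫ path.eval (path K) true, hom_ext_cell fun n x => ?_, hom_ext_cell fun n x => ?_⟩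
  · exact (hend x).2 false
  · exact ((hend x).2 true).trans (path.eval_const (ev (path.eval K true) (ev h x)) true)

theorem ElementaryHomotopic.equivalence {X K : CSet.{u}} (hK : IsKan K) :
    Equivalence (fun f g : X ⟶ K => ElementaryHomotopic f g) where
  refl := .refl
  symm h := ElementaryHomotopic.move_source hK (.refl _) h
  trans h h' := ElementaryHomotopic.move_source hK h'
    (ElementaryHomotopic.move_source hK (.refl _) h)

theorem HomotopyClasses.mk_eq_iff {X K : CSet.{u}} (hK : IsKan K) {f g : X ⟶ K} :
    (Quot.mk _ f : HomotopyClasses X K) = Quot.mk _ g ↔ ElementaryHomotopic f g := by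
  rw [Quot.eq, (ElementaryHomotopic.equivalence hK).eqvGen_iff]

end CSet

/-! ### Extension along deformations -/

namespace CSet

/-- Let `h` be a homotopy from a map `η : Y ⟶ Y` to the identity which commutes with `η`. A section
of a Kan correspondence, defined on a cubical subset which is stable under `h` and into which
every cube is eventually moved by `η`, extends to `Y`. The subset need not be reached after a
bounded number of steps, so a maximal section is considered: if `M` is its domain, its
composite with `η` is defined on the inverse image of `M` under `η`, and transport along `h`
makes the latter an extension of the given section. -/
theorem Corr.KanFilling.exists_extension {Y E : CSet.{u}} {R : Corr Y E} (hR : R.KanFilling)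
    (h : Y ⟶ path Y) (η : Y ⟶ Y) (h₀ : h ≫ path.eval Y false = η)
    (h₁ : h ≫ path.eval Y true = 𝟙 Y) (hη : h ≫ path.map η = η ≫ h) {Γ : Corr Y E}
    (hΓ : Γ.Functional) (hΓR : Γ ≤ R)
    (hstab : ∀ {n : ℕ} (y : Y.cell n), Γ.Dom y → Γ.Dom (path.cube (ev h y)))
    (hev : ∀ {n : ℕ} (y : Y.cell n), ∃ k : ℕ, Γ.Dom ((ev η)^[k] y)) :
    ∃ f : Y ⟶ E, (∀ {n : ℕ} (y : Y.cell n), R.rel y (ev f y)) ∧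
      ∀ {n : ℕ} {y : Y.cell n} {e : E.cell n}, Γ.rel y e → ev f y = e := by
  have h0 : ∀ {n : ℕ} (y : Y.cell n), path.cube (ev h y) ◃ Box.coface (Fin.last n) false =
      ev η y := fun y => by rw [← h₀]; rfl
  have h1 : ∀ {n : ℕ} (y : Y.cell n), path.cube (ev h y) ◃ Box.coface (Fin.last n) true = y :=
    fun {n} y => congrArg (fun f : Y ⟶ Y => ev f y) h₁
  have hcomm : ∀ {n : ℕ} (y : Y.cell n), ev η (path.cube (ev h y)) = path.cube (ev h (ev η y)) :=
    fun {n} y => congrArg (fun f : Y ⟶ path Y => path.cube (ev f y)) hη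
  obtain ⟨M, hΓM, hM⟩ := zorn_le_nonempty₀ {Γ' : Corr Y E | Γ'.Functional ∧ Γ' ≤ R ∧
      ∀ {n : ℕ} (y : Y.cell n), Γ'.Dom y → Γ'.Dom (path.cube (ev h y))}
    (fun c hc hchain Γ₀ hΓ₀ => ⟨Corr.sUnion c,
      ⟨Functional.sUnion hchain fun Γ' h => (hc h).1,
        fun _ _ _ ⟨Γ', h, hr⟩ => (hc h).2.1 hr,
        fun {n} y ⟨e, Γ', h, hr⟩ => by
          obtain ⟨e', he'⟩ := (hc h).2.2 y ⟨e, hr⟩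
          exact ⟨e', Γ', h, he'⟩⟩,
      fun Γ' h _ _ _ hr => ⟨Γ', h, hr⟩⟩) Γ ⟨hΓ, hΓR, hstab⟩
  obtain ⟨hMf, hMR, hMs⟩ := hM.prop
  -- the cubes moved by `η` into the domain of a maximal section `M`, and the composite of `M` and `η`
  let X : Subfunctor Y :=
    { obj := fun a => {y | M.Dom (n := a.unop.dim) (ev η (n := a.unop.dim) y)}
      map := fun {a b} σ y hy => by
        have hy' : M.Dom (ev η (n := a.unop.dim) y) := hy
        have h2 := hy'.res (m := b.unop.dim) σ.unop
        rw [← ev_res] at h2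
        exact h2 }
  obtain ⟨F, hF⟩ := exists_hom_of_total (Γ := M.pullback (X.ι ≫ η)) (fun _ _ _ _ h h' => hMf h h')
    (fun n y => y.2)
  let Γ' : Corr X.toFunctor (path E) :=
    ⟨fun y e => M.rel (path.cube (ev (X.ι ≫ h) y)) (path.cube e), fun σ hr => by
      rw [ev_res, path.cube_res, path.cube_res]
      exact M.res _ hr⟩
  obtain ⟨f, hfR, hfΓ⟩ := (hR.pathFrom (X.ι ≫ h) F (fun {n} y => by
      have h2 : M.rel (ev η (ev X.ι y)) (ev F y) := hF n y
      rw [← h0] at h2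
      exact hMR h2)).exists_extension (Γ := Γ') (fun _ _ _ _ hr hr' => hMf hr hr')
    (fun n y e hr => ⟨hMR hr, by
      have h2 := M.res (Box.coface (Fin.last n) false) hr
      rw [ev_comp, h0] at h2
      exact hMf h2 (hF n y)⟩)
  let M' : Corr Y E :=
    ⟨fun {n} y e => ∃ hy : M.Dom (ev η y),
      e = ev (path.eval E true) (ev f (⟨y, hy⟩ : CSet.cell X.toFunctor n)), by
        rintro m n y e σ ⟨hy, rfl⟩
        have hy' : M.Dom (ev η (y ◃ σ)) := by rw [ev_res]; exact hy.res σ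
        have h2 := ev_res (f ≫ path.eval E true) (⟨y, hy⟩ : CSet.cell X.toFunctor n) σ
        exact ⟨hy', h2.symm⟩⟩
  have hMM' : M ≤ M' := by
    intro n y e hr
    have hd := hMs y ⟨e, hr⟩
    have hy : M.Dom (ev η y) := by rw [← h0]; exact hd.res _
    obtain ⟨e', he'⟩ := hd
    refine ⟨hy, ?_⟩
    rw [hfΓ (y := (⟨y, hy⟩ : CSet.cell X.toFunctor n)) (e := path.ofCube e') he']
    have h2 := M.res (Box.coface (Fin.last n) true) he'
    rw [h1] at h2
    exact hMf hr h2
  have hM'M : M' ≤ M := by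
    refine hM.le_of_ge ⟨?_, ?_, ?_⟩ hMM'
    · rintro n y e e' ⟨_, rfl⟩ ⟨_, rfl⟩
      rfl
    · rintro n y e ⟨hy, rfl⟩
      have h2 : R.rel (path.cube (ev h y) ◃ Box.coface (Fin.last n) true) _ :=
        R.res _ (hfR (⟨y, hy⟩ : CSet.cell X.toFunctor n)).1
      rw [h1] at h2
      exact h2
    · rintro n y ⟨_, hy, -⟩
      refine ⟨_, ?_, rfl⟩
      rw [hcomm]
      exact hMs _ hy
  have hback : ∀ {n : ℕ} (y : Y.cell n), M.Dom (ev η y) → M.Dom y := fun y hy =>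
    ⟨_, hM'M ⟨hy, rfl⟩⟩
  have htot : ∀ (k n : ℕ) (y : Y.cell n), M.Dom ((ev η)^[k] y) → M.Dom y := by
    intro k
    induction k with
    | zero => exact fun n y hy => hy
    | succ k ih => exact fun n y hy => hback y (ih n _ hy)
  obtain ⟨f, hf⟩ := exists_hom_of_total hMf (fun n y => by
    obtain ⟨k, e, he⟩ := hev y
    exact htot k n y ⟨e, hΓM he⟩)
  exact ⟨f, fun y => hMR (hf _ y), fun h => hMf (hf _ _) (hΓM h)⟩

end CSet

/-! ### Cubes of digraphs -/

namespace DGra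

open CSet

section

variable {D D' : DGra.{u}} {m n : ℕ}

/-- The vertices of a cube of a digraph. -/
def vert (y : (N₁.obj D).cell n) (v : Cube n) : D.V := Hom.toFun y v

theorem cell_ext {y y' : (N₁.obj D).cell n} (h : ∀ v, vert y v = vert y' v) : y = y' :=
  Hom.ext (funext h)

theorem vert_res (y : (N₁.obj D).cell n) (σ : (⟨m⟩ : Box) ⟶ ⟨n⟩) (v : Cube m) :
    vert (y ◃ σ) v = vert y (σ.toFun v) := rfl

theorem arr_vert (y : (N₁.obj D).cell n) {v : Cube n} {i : Fin n} (hi : v i = false) :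
    D.Arr (vert y v) (vert y (Function.update v i true)) := by
  refine Hom.map_arr y (Or.inr ⟨i, ?_, fun j hj => (Function.update_of_ne hj _ _).symm⟩)
  change v i ≤ Function.update v i true i
  rw [hi]
  exact Bool.false_le _

/-- A cube of a digraph, given by its vertices. -/
def ofVert (F : Cube n → D.V)
    (hF : ∀ (v : Cube n) (i : Fin n), v i = false → D.Arr (F v) (F (Function.update v i true))) :
    (N₁.obj D).cell n :=
  (⟨F, by
    rintro (v : Cube n) (w : Cube n) (rfl | ⟨i, hi, h⟩)
    · exact D.refl _
    by_cases hvw : v i = w i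
    · obtain rfl : v = w := funext fun j => by
        by_cases hj : j = i
        · rw [hj, hvw]
        · exact h j hj
      exact D.refl _
    have hi' : v i = false ∧ w i = true := by
      have hle : v i ≤ w i := hi
      revert hvw hle
      cases v i <;> cases w i <;> simp
    obtain rfl : w = Function.update v i true := by
      funext j
      by_cases hj : j = i
      · subst hj; rw [hi'.2, Function.update_self]
      · rw [Function.update_of_ne hj]; exact (h j hj).symm
    exact hF v i hi'.1⟩ : Hom (I₁.boxPow n) D)

@[simp] theorem vert_ofVert (F : Cube n → D.V)
    (hF : ∀ (v : Cube n) (i : Fin n), v i = false → D.Arr (F v) (F (Function.update v i true)))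
    (v : Cube n) : vert (ofVert F hF) v = F v := rfl

/-- If a cube of a digraph has a vertex in an in-closed set, then so are all the smaller
vertices. -/
theorem InClosed.vert_mem_of_le {S : Set D.V} (hS : D.InClosed S) (y : (N₁.obj D).cell n)
    {v w : Cube n} (hvw : v ≤ w) (hw : vert y w ∈ S) : vert y v ∈ S := by
  suffices H : ∀ s : Finset (Fin n), vert y (s.piecewise v w) ∈ S by
    have := H Finset.univ
    rwa [Finset.piecewise_univ] at this
  intro s
  induction s using Finset.induction_on with
  | empty => rwa [Finset.piecewise_empty]
  | insert a s ha ih =>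
    have hwa : s.piecewise v w a = w a := Finset.piecewise_eq_of_notMem _ _ _ ha
    rw [Finset.piecewise_insert]
    by_cases hva : v a = w a
    · rwa [hva, ← hwa, Function.update_eq_self]
    · have h01 : v a = false ∧ w a = true := by
        have hle := hvw a
        revert hva hle
        cases v a <;> cases w a <;> simp
      have harr := arr_vert y (v := Function.update (s.piecewise v w) a (v a)) (i := a)
        (by rw [Function.update_self, h01.1])
      rw [Function.update_idem, ← h01.2, ← hwa, Function.update_eq_self] at harr
      exact hS harr ih

theorem OutClosed.vert_mem_of_le {S : Set D.V} (hS : D.OutClosed S) (y : (N₁.obj D).cell n)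
    {v w : Cube n} (hvw : v ≤ w) (hv : vert y v ∈ S) : vert y w ∈ S := by
  by_contra hw
  have hc : D.InClosed Sᶜ := fun g g' h hg' hg => hg' (hS h hg)
  exact hc.vert_mem_of_le y hvw hw hv

end

/-- The homotopy of cubical nerves, from `η` to the identity, given by arrows `η g → g`. -/
def homotopyToId {D : DGra.{u}} (η : D ⟶ D) (hη : ∀ g, D.Arr (η.toFun g) g) :
    N₁.obj D ⟶ path (N₁.obj D) :=
  homMk (fun n y => path.ofCube (Y := N₁.obj D) (ofVert
      (fun x : Cube (n + 1) => if x (Fin.last n) then vert y (Fin.init x) else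
        η.toFun (vert y (Fin.init x))) (by
      intro v i hi
      induction i using Fin.lastCases with
      | last =>
        rw [Fin.init_update_last, hi, Function.update_self]
        exact hη _
      | cast i =>
        have hy := arr_vert y (v := Fin.init v) (i := i) hi
        rw [Fin.init_update_castSucc, Function.update_of_ne (Fin.castSucc_lt_last i).ne']
        split_ifs
        · exact hy
        · exact η.map_arr hy))) (fun {m n} y σ => by
    refine cell_ext fun x : Cube (m + 1) => ?_
    change (if x (Fin.last m) then _ else _) =
      (if Cube.tensorInterval σ.toFun x (Fin.last n) then
        vert y (Fin.init (Cube.tensorInterval σ.toFun x)) else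
        η.toFun (vert y (Fin.init (Cube.tensorInterval σ.toFun x))))
    simp only [Cube.tensorInterval, Fin.snoc_last, Fin.init_snoc, vert_res])

theorem vert_homotopyToId {D : DGra.{u}} (η : D ⟶ D) (hη : ∀ g, D.Arr (η.toFun g) g) {n : ℕ}
    (y : (N₁.obj D).cell n) (x : Cube (n + 1)) :
    vert (path.cube (ev (homotopyToId η hη) y)) x =
      if x (Fin.last n) then vert y (Fin.init x) else η.toFun (vert y (Fin.init x)) := rfl

theorem vert_eval_homotopyToId {D : DGra.{u}} (η : D ⟶ D) (hη : ∀ g, D.Arr (η.toFun g) g) {n : ℕ}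
    (y : (N₁.obj D).cell n) (ε : Bool) (x : Cube n) :
    vert (ev (path.eval _ ε) (ev (homotopyToId η hη) y)) x =
      if ε then vert y x else η.toFun (vert y x) := by
  have h1 : Cube.coface (Fin.last n) ε x (Fin.last n) = ε := Cube.coface_same _ _ _
  have h2 : Fin.init (Cube.coface (Fin.last n) ε x) = x := by
    simp [Cube.coface]
  rw [path.ev_eval, vert_res, vert_homotopyToId]
  change (if Cube.coface (Fin.last n) ε x (Fin.last n) then
    vert y (Fin.init (Cube.coface (Fin.last n) ε x)) else
    η.toFun (vert y (Fin.init (Cube.coface (Fin.last n) ε x)))) = _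
  rw [h1, h2]

/-- A section of a Kan correspondence over the nerve of a digraph, defined on the nerve of an
in-closed subdigraph into which every vertex is eventually moved by `η`, extends to the whole
nerve. -/
theorem exists_extension {D : DGra.{u}} {S : Set D.V} (hS : D.InClosed S) (η : D ⟶ D)
    (hη : ∀ g, D.Arr (η.toFun g) g) (hev : ∀ g, ∃ k : ℕ, η.toFun^[k] g ∈ S) {E : CSet.{u}}
    {R : Corr (N₁.obj D) E} (hR : R.KanFilling) {Γ : Corr (N₁.obj D) E} (hΓ : Γ.Functional)
    (hΓR : Γ ≤ R)
    (hdom : ∀ {n : ℕ} (y : (N₁.obj D).cell n), Γ.Dom y ↔ ∀ v, vert y v ∈ S) :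
    ∃ f : N₁.obj D ⟶ E, (∀ {n : ℕ} (y : (N₁.obj D).cell n), R.rel y (ev f y)) ∧
      ∀ {n : ℕ} {y : (N₁.obj D).cell n} {e : E.cell n}, Γ.rel y e → ev f y = e := by
  refine hR.exists_extension (homotopyToId η hη) (N₁.map η) ?_ ?_ ?_ hΓ hΓR ?_ ?_
  · exact hom_ext_cell fun n y => cell_ext fun x => vert_eval_homotopyToId η hη y false x
  · exact hom_ext_cell fun n y => cell_ext fun x => vert_eval_homotopyToId η hη y true x
  · refine hom_ext_cell fun n y => cell_ext (n := n + 1) fun x => ?_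
    change η.toFun (if x (Fin.last n) then _ else _) = (if x (Fin.last n) then _ else _)
    split_ifs <;> rfl
  · intro n y hy
    rw [hdom] at hy ⊢
    intro v
    rw [vert_homotopyToId]
    split_ifs
    · exact hy _
    · exact hS (hη _) (hy _)
  · intro n y
    -- the greatest vertex of the cube is moved into `S`, hence so is the whole cube
    obtain ⟨k, hk⟩ := hev (vert y fun _ => true)
    have hit : ∀ (k : ℕ) (y : (N₁.obj D).cell n) (v : Cube n),
        vert ((ev (N₁.map η))^[k] y) v = η.toFun^[k] (vert y v) := by
      intro k
      induction k with
      | zero => exact fun y v => rfl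
      | succ k ih => exact fun y v => ih _ v
    refine ⟨k, (hdom _).2 fun v => hS.vert_mem_of_le _ (fun _ => Bool.le_true _) ?_⟩
    rw [hit]
    exact hk

end DGra

/-! ### Pushouts of digraphs along in-closed inclusions -/

namespace DGra

/-- The digraph with two vertices, namely the truth values, and all the arrows. It classifies sets
of vertices. -/
def truth : DGra.{u} where
  V := ULift Prop
  graph := ⟨fun _ _ => True⟩
  refl _ := trivial

/-- The map to `truth` given by a set of vertices. -/
def classify {D : DGra.{u}} (α : D.V → Prop) : D ⟶ truth.{u} :=
  (⟨fun g => ⟨α g⟩, fun _ => trivial⟩ : Hom D truth)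

section Pushout

variable {H G H' G' : DGra.{u}} {i : H ⟶ G} {φ : H ⟶ H'} {φ' : G ⟶ G'} {i' : H' ⟶ G'}

theorem pushout_comm (hsq : IsPushout i φ φ' i') (h : H.V) :
    φ'.toFun (i.toFun h) = i'.toFun (φ.toFun h) :=
  congrArg (fun f : H ⟶ G' => f.toFun h) hsq.w

/-- The universal property of a pushout of digraphs, for sets of vertices. -/
theorem exists_pred_of_pushout (hsq : IsPushout i φ φ' i') (α : G.V → Prop) (β : H'.V → Prop)
    (hαβ : ∀ h, α (i.toFun h) ↔ β (φ.toFun h)) :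
    ∃ γ : G'.V → Prop, (∀ g, γ (φ'.toFun g) ↔ α g) ∧ ∀ h', γ (i'.toFun h') ↔ β h' := by
  have hw : i ≫ classify α = φ ≫ classify β :=
    Hom.ext (funext fun h => congrArg ULift.up (propext (hαβ h)))
  let d : G' ⟶ truth := hsq.desc (classify α) (classify β) hw
  refine ⟨fun x => (d.toFun x).down, fun g => ?_, fun h' => ?_⟩
  · have := congrArg (fun f : G ⟶ truth => (f.toFun g).down)
      (hsq.inl_desc (classify α) (classify β) hw)
    exact Iff.of_eq this
  · have := congrArg (fun f : H' ⟶ truth => (f.toFun h').down)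
      (hsq.inr_desc (classify α) (classify β) hw)
    exact Iff.of_eq this

theorem pushout_cases (hsq : IsPushout i φ φ' i') (x : G'.V) :
    (∃ g, φ'.toFun g = x) ∨ ∃ h', i'.toFun h' = x := by
  have h : classify (D := G') (fun x => (∃ g, φ'.toFun g = x) ∨ ∃ h', i'.toFun h' = x) =
      classify (fun _ => True) := by
    refine hsq.hom_ext (Hom.ext (funext fun g => ?_)) (Hom.ext (funext fun h' => ?_))
    · exact congrArg ULift.up (eq_true (Or.inl ⟨g, rfl⟩))
    · exact congrArg ULift.up (eq_true (Or.inr ⟨h', rfl⟩))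
  have h1 := congrArg (fun f : G' ⟶ truth => (f.toFun x).down) h
  exact of_eq_true h1

/-- A pushout of digraphs has only the arrows which it must have. -/
theorem pushout_arr_cases (hsq : IsPushout i φ φ' i') {x y : G'.V} (hxy : G'.Arr x y) :
    x = y ∨ (∃ g g', G.Arr g g' ∧ φ'.toFun g = x ∧ φ'.toFun g' = y) ∨
      ∃ h h', H'.Arr h h' ∧ i'.toFun h = x ∧ i'.toFun h' = y := by
  -- the subdigraph of `G'` with only the arrows which come from `G` and `H'`
  let T : DGra.{u} :=
    { V := G'.V
      graph := ⟨fun x y => x = y ∨ (∃ g g', G.Arr g g' ∧ φ'.toFun g = x ∧ φ'.toFun g' = y) ∨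
        ∃ h h', H'.Arr h h' ∧ i'.toFun h = x ∧ i'.toFun h' = y⟩
      refl := fun _ => Or.inl rfl }
  let ι : T ⟶ G' := (⟨fun x => x, by
    rintro x y (rfl | ⟨g, g', h, rfl, rfl⟩ | ⟨g, g', h, rfl, rfl⟩)
    · exact G'.refl _
    · exact φ'.map_arr h
    · exact i'.map_arr h⟩ : Hom T G')
  let a : G ⟶ T := (⟨φ'.toFun, fun h => Or.inr (Or.inl ⟨_, _, h, rfl, rfl⟩)⟩ : Hom G T)
  let b : H' ⟶ T := (⟨i'.toFun, fun h => Or.inr (Or.inr ⟨_, _, h, rfl, rfl⟩)⟩ : Hom H' T)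
  have hab : i ≫ a = φ ≫ b := Hom.ext (funext fun h => pushout_comm hsq h)
  let d : G' ⟶ T := hsq.desc a b hab
  have hd : d ≫ ι = 𝟙 G' := by
    refine hsq.hom_ext ?_ ?_
    · rw [← Category.assoc, hsq.inl_desc, Category.comp_id]; rfl
    · rw [← Category.assoc, hsq.inr_desc, Category.comp_id]; rfl
  have hd' : ∀ x, d.toFun x = x := fun x => congrArg (fun f : G' ⟶ G' => f.toFun x) hd
  have h1 := d.map_arr hxy
  rw [hd', hd'] at h1
  exact h1

theorem pushout_inl_eq_inl (hsq : IsPushout i φ φ' i') {g g' : G.V}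
    (hg : g ∉ Set.range i.toFun) (h : φ'.toFun g = φ'.toFun g') : g = g' := by
  obtain ⟨γ, hγ, -⟩ := exists_pred_of_pushout hsq (fun a => a = g) (fun _ => False)
    fun h => ⟨fun e => hg ⟨h, e⟩, False.elim⟩
  exact ((hγ g').1 (h ▸ (hγ g).2 rfl)).symm

theorem pushout_inl_eq_inr (hsq : IsPushout i φ φ' i') {g : G.V} {h' : H'.V}
    (h : φ'.toFun g = i'.toFun h') : g ∈ Set.range i.toFun := by
  by_contra hg
  obtain ⟨γ, hγ, hγ'⟩ := exists_pred_of_pushout hsq (fun a => a = g) (fun _ => False)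
    fun h => ⟨fun e => hg ⟨h, e⟩, False.elim⟩
  exact (hγ' h').1 (h ▸ (hγ g).2 rfl)

theorem pushout_inr_injective (hsq : IsPushout i φ φ' i') (hi : Function.Injective i.toFun) :
    Function.Injective i'.toFun := by
  intro h₀ h₁ he
  obtain ⟨γ, -, hγ⟩ := exists_pred_of_pushout hsq
    (fun a => ∃ h, i.toFun h = a ∧ φ.toFun h = h₀) (fun h' => h' = h₀)
    fun h => ⟨fun ⟨k, hk, hk'⟩ => hi hk ▸ hk', fun e => ⟨h, rfl, e⟩⟩
  exact ((hγ h₁).1 (he ▸ (hγ h₀).2 rfl)).symm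

theorem pushout_inl_mem_range_inr_iff (hsq : IsPushout i φ φ' i') {g : G.V} :
    φ'.toFun g ∈ Set.range i'.toFun ↔ g ∈ Set.range i.toFun := by
  refine ⟨fun ⟨h', e⟩ => pushout_inl_eq_inr hsq e.symm, ?_⟩
  rintro ⟨h, rfl⟩
  exact ⟨_, (pushout_comm hsq h).symm⟩

theorem inClosed_range_inr (hsq : IsPushout i φ φ' i') (hi : G.InClosed (Set.range i.toFun)) :
    G'.InClosed (Set.range i'.toFun) := by
  intro x y hxy hy
  rcases pushout_arr_cases hsq hxy with rfl | ⟨g, g', h, rfl, rfl⟩ | ⟨h, h', -, rfl, rfl⟩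
  · exact hy
  · rw [pushout_inl_mem_range_inr_iff hsq] at hy ⊢
    exact hi h hy
  · exact ⟨h, rfl⟩

theorem subset_outClosure (D : DGra.{u}) (S : Set D.V) : S ⊆ D.outClosure S :=
  Set.subset_sInter fun _ hT => hT.2

theorem outClosed_outClosure (D : DGra.{u}) (S : Set D.V) : D.OutClosed (D.outClosure S) :=
  fun _ _ h hg _ hT => hT.1 h (hg _ hT)

/-- The union in the pushout `G'` of the image of `H'` and of the image of the out-closure of `H`. -/
def outPushout (i : H ⟶ G) (φ' : G ⟶ G') (i' : H' ⟶ G') : Set G'.V :=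
  Set.range i'.toFun ∪ φ'.toFun '' G.outClosure (Set.range i.toFun)

theorem pushout_inl_mem_outPushout_iff (hsq : IsPushout i φ φ' i') {g : G.V} :
    φ'.toFun g ∈ outPushout i φ' i' ↔ g ∈ G.outClosure (Set.range i.toFun) := by
  refine ⟨?_, fun hg => Or.inr ⟨g, hg, rfl⟩⟩
  rintro (h | ⟨g', hg', h⟩)
  · exact G.subset_outClosure _ ((pushout_inl_mem_range_inr_iff hsq).1 h)
  · by_cases hg : g ∈ Set.range i.toFun
    · exact G.subset_outClosure _ hg
    · rwa [pushout_inl_eq_inl hsq hg h.symm]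

theorem outClosed_outPushout (hsq : IsPushout i φ φ' i') :
    G'.OutClosed (outPushout i φ' i') := by
  intro x y hxy hx
  rcases pushout_arr_cases hsq hxy with rfl | ⟨g, g', h, rfl, rfl⟩ | ⟨h, h', -, rfl, rfl⟩
  · exact hx
  · rw [pushout_inl_mem_outPushout_iff hsq] at hx ⊢
    exact G.outClosed_outClosure _ h hx
  · exact Or.inl ⟨h', rfl⟩

/-- An arrow of the pushout between vertices outside the image of `H'` lifts to `G`. -/
theorem exists_arr_of_notMem (hsq : IsPushout i φ φ' i') {g g' : G.V}
    (hg : g ∉ Set.range i.toFun) (hg' : g' ∉ Set.range i.toFun)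
    (h : G'.Arr (φ'.toFun g) (φ'.toFun g')) : G.Arr g g' := by
  rcases pushout_arr_cases hsq h with e | ⟨a, a', h, ha, ha'⟩ | ⟨a, a', -, ha, -⟩
  · rw [pushout_inl_eq_inl hsq hg e]
    exact G.refl _
  · rwa [pushout_inl_eq_inl hsq hg ha.symm, pushout_inl_eq_inl hsq hg' ha'.symm]
  · exact absurd (pushout_inl_eq_inr hsq ha.symm) hg

end Pushout

/-! ### Directed deformation retracts -/

/-- The inclusion of an induced subdigraph. -/
def inclusion (D : DGra.{u}) (S : Set D.V) : D.induce S ⟶ D :=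
  (⟨fun g => g.1, fun h => h⟩ : Hom (D.induce S) D)

/-- Every vertex of the out-closure is reached by a path from `S` inside the out-closure. -/
theorem exists_hasPath_outClosure (D : DGra.{u}) (S : Set D.V)
    (g : (D.induce (D.outClosure S)).V) : ∃ h : (D.induce (D.outClosure S)).V, h.1 ∈ S ∧
      ∃ n, (D.induce (D.outClosure S)).HasPath n h g := by
  let T : Set D.V := {g | ∃ (hg : g ∈ D.outClosure S) (h : (D.induce (D.outClosure S)).V),
    h.1 ∈ S ∧ ∃ n, (D.induce (D.outClosure S)).HasPath n h ⟨g, hg⟩}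
  have hT : D.outClosure S ⊆ T := by
    refine Set.sInter_subset_of_mem ⟨?_, ?_⟩
    · rintro a b hab ⟨ha, h, hh, n, hn⟩
      exact ⟨D.outClosed_outClosure S hab ha, h, hh, n + 1, ⟨a, ha⟩, hn, hab⟩
    · intro a ha
      exact ⟨D.subset_outClosure S ha, ⟨a, D.subset_outClosure S ha⟩, ha, 0, rfl⟩
  obtain ⟨_, h⟩ := hT g.2
  exact h

/-- The third condition on a directed deformation retract makes every vertex at finite distance
from the retract reach it under iteration. -/
theorem exists_iterate_mem {D : DGra.{u}} {S : Set D.V} {η : D.V → D.V}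
    (hη : ∀ g ∉ S, ∀ h ∈ S, D.dist h g = D.dist h (η g) + 1) {h g : D.V} (hh : h ∈ S) {n : ℕ}
    (hn : D.HasPath n h g) : ∃ k : ℕ, η^[k] g ∈ S := by
  have hle : D.dist h g ≤ n := iInf₂_le n hn
  clear hn
  induction n generalizing g with
  | zero =>
    by_contra! hcon
    rw [hη g (hcon 0) h hh] at hle
    simp at hle
  | succ n ih =>
    by_cases hg : g ∈ S
    · exact ⟨0, hg⟩
    · rw [hη g hg h hh, Nat.cast_succ] at hle
      obtain ⟨k, hk⟩ := ih ((ENat.add_le_add_iff_right (by simp)).1 hle)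
      exact ⟨k + 1, hk⟩

/-- An ODDR-subdigraph is a deformation retract of its out-closure, in that every vertex of the
out-closure is eventually moved into it. -/
theorem IsODDR.exists_deformation {D : DGra.{u}} {S : Set D.V} (hS : D.IsODDR S) :
    ∃ η : D.induce (D.outClosure S) ⟶ D.induce (D.outClosure S),
      (∀ g, (D.induce (D.outClosure S)).Arr (η.toFun g) g) ∧ (∀ g, g.1 ∈ S → η.toFun g = g) ∧
        ∀ g, ∃ k : ℕ, η.toFun^[k] g ∈ {g : (D.induce (D.outClosure S)).V | g.1 ∈ S} := by
  obtain ⟨-, -, η, hη, hfix, hdist⟩ := hS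
  refine ⟨η, hη, hfix, fun g => ?_⟩
  obtain ⟨h, hh, n, hn⟩ := D.exists_hasPath_outClosure S g
  exact exists_iterate_mem hdist hh hn

/-- A deformation of the out-closure of `H` onto `H` induces one of `outPushout` onto `H'`. -/
theorem exists_deformation_outPushout {H G H' G' : DGra.{u}} {i : H ⟶ G} {φ : H ⟶ H'}
    {φ' : G ⟶ G'} {i' : H' ⟶ G'} (hi : G.IsODDR (Set.range i.toFun))
    (hsq : IsPushout i φ φ' i') :
    ∃ η' : G'.induce (outPushout i φ' i') ⟶ G'.induce (outPushout i φ' i'),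
      (∀ g, (G'.induce (outPushout i φ' i')).Arr (η'.toFun g) g) ∧
        ∀ g, ∃ k : ℕ, η'.toFun^[k] g ∈
          {g : (G'.induce (outPushout i φ' i')).V | g.1 ∈ Set.range i'.toFun} := by
  obtain ⟨η, hη, hfix, hev⟩ := hi.exists_deformation
  have hmem : ∀ g : (G.induce (G.outClosure (Set.range i.toFun))).V,
      φ'.toFun g.1 ∈ outPushout i φ' i' := fun g => Or.inr ⟨g.1, g.2, rfl⟩
  -- `η'` is the identity on `H'` and is induced by `η` elsewhere
  have hex : ∀ x : (G'.induce (outPushout i φ' i')).V, ∃ y : (G'.induce (outPushout i φ' i')).V,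
      (x.1 ∈ Set.range i'.toFun → y = x) ∧
        ∀ g, φ'.toFun g.1 = x.1 → y.1 = φ'.toFun (η.toFun g).1 := by
    rintro ⟨x, hx⟩
    by_cases hx' : x ∈ Set.range i'.toFun
    · refine ⟨⟨x, hx⟩, fun _ => rfl, fun g hg => ?_⟩
      have hg' : g.1 ∈ Set.range i.toFun :=
        (pushout_inl_mem_range_inr_iff hsq).1 (hg.symm ▸ hx')
      exact hg.symm.trans (congrArg (fun g => φ'.toFun (Subtype.val g)) (hfix g hg').symm)
    · rcases hx with hx | ⟨g, hg, rfl⟩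
      · exact absurd hx hx'
      · refine ⟨⟨φ'.toFun (η.toFun ⟨g, hg⟩).1, hmem _⟩, fun h => absurd h hx', fun g' hg' => ?_⟩
        have : g = g'.1 := pushout_inl_eq_inl hsq
          (fun h => hx' ((pushout_inl_mem_range_inr_iff hsq).2 h)) hg'.symm
        subst this
        rfl
  choose F hF₁ hF₂ using hex
  have hF₃ : ∀ g, F ⟨φ'.toFun g.1, hmem g⟩ = ⟨φ'.toFun (η.toFun g).1, hmem _⟩ :=
    fun g => Subtype.ext (hF₂ _ g rfl)
  refine ⟨(⟨F, ?_⟩ : Hom _ _), ?_, ?_⟩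
  · rintro ⟨x, hx⟩ ⟨y, hy⟩ hxy
    have hxy' : G'.Arr x y := hxy
    rcases pushout_arr_cases hsq hxy' with rfl | ⟨g, g', h, rfl, rfl⟩ | ⟨h, h', harr, rfl, rfl⟩
    · exact G'.refl _
    · have hg := (pushout_inl_mem_outPushout_iff hsq).1 hx
      have hg' := (pushout_inl_mem_outPushout_iff hsq).1 hy
      have harr := η.map_arr (g := ⟨g, hg⟩) (g' := ⟨g', hg'⟩) h
      have e : G'.Arr (F ⟨φ'.toFun g, hmem ⟨g, hg⟩⟩).1 (F ⟨φ'.toFun g', hmem ⟨g', hg'⟩⟩).1 := by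
        rw [hF₃ ⟨g, hg⟩, hF₃ ⟨g', hg'⟩]
        exact φ'.map_arr harr
      exact e
    · have e := hF₁ ⟨i'.toFun h, hx⟩ ⟨h, rfl⟩
      have e' := hF₁ ⟨i'.toFun h', hy⟩ ⟨h', rfl⟩
      exact e.symm ▸ e'.symm ▸ hxy
  · rintro ⟨x, hx⟩
    rcases id hx with hx' | ⟨g, hg, rfl⟩
    · have e := hF₁ ⟨x, hx⟩ hx'
      exact (congrArg (fun y => G'.Arr (Subtype.val y) x) e).mpr (G'.refl x)
    · exact (congrArg (fun y => G'.Arr (Subtype.val y) (φ'.toFun g)) (hF₃ ⟨g, hg⟩)).mpr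
        (φ'.map_arr (hη ⟨g, hg⟩))
  · rintro ⟨x, hx⟩
    rcases id hx with hx' | ⟨g, hg, rfl⟩
    · exact ⟨0, hx'⟩
    · obtain ⟨k, hk⟩ := hev ⟨g, hg⟩
      refine ⟨k, ?_⟩
      have hit : ∀ (k : ℕ) (g : (G.induce (G.outClosure (Set.range i.toFun))).V),
          F^[k] ⟨φ'.toFun g.1, hmem g⟩ = ⟨φ'.toFun (η.toFun^[k] g).1, hmem _⟩ := by
        intro k
        induction k with
        | zero => exact fun _ => rfl
        | succ k ih => exact fun g => (congrArg F^[k] (hF₃ g)).trans (ih (η.toFun g))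
      have h1 := hit k ⟨g, hg⟩
      exact (congrArg (fun y => Subtype.val y ∈ Set.range i'.toFun) h1).mpr
        ((pushout_inl_mem_range_inr_iff hsq).2 hk)

end DGra

/-! ### Cubical nerves of induced inclusions -/

namespace DGra

open CSet

/-- The map `f` is an isomorphism onto an induced subdigraph. -/
def IsInducedInclusion {D D' : DGra.{u}} (f : D ⟶ D') : Prop :=
  Function.Injective f.toFun ∧ ∀ ⦃g g' : D.V⦄, D'.Arr (f.toFun g) (f.toFun g') → D.Arr g g'

theorem isInducedInclusion_inclusion (D : DGra.{u}) (S : Set D.V) :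
    IsInducedInclusion (D.inclusion S) :=
  ⟨Subtype.val_injective, fun _ _ h => h⟩

theorem ev_map_injective {D D' : DGra.{u}} {f : D ⟶ D'} (hf : Function.Injective f.toFun) {n : ℕ}
    {x y : (N₁.obj D).cell n} (h : ev (N₁.map f) x = ev (N₁.map f) y) : x = y :=
  cell_ext fun v => hf (congrArg (fun z : (N₁.obj D').cell n => vert z v) h)

theorem mono_map {D D' : DGra.{u}} {f : D ⟶ D'} (hf : Function.Injective f.toFun) :
    Mono (N₁.map f) :=
  ⟨fun _ _ h => hom_ext_cell fun _ x => ev_map_injective hf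
    (congrArg (fun k => ev k x) h)⟩

/-- The nerve of an induced subdigraph consists of the cubes all of whose vertices are there. -/
theorem IsInducedInclusion.exists_cell {D D' : DGra.{u}} {f : D ⟶ D'} (hf : IsInducedInclusion f)
    {n : ℕ} {y : (N₁.obj D').cell n} (hy : ∀ v, vert y v ∈ Set.range f.toFun) :
    ∃ x, ev (N₁.map f) x = y := by
  choose F hF using hy
  refine ⟨ofVert F fun v i hi => hf.2 ?_, cell_ext hF⟩
  rw [hF, hF]
  exact arr_vert y hi

theorem exists_cell_inclusion {D : DGra.{u}} {S : Set D.V} {n : ℕ} {y : (N₁.obj D).cell n}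
    (hy : ∀ v, vert y v ∈ S) : ∃ x, ev (N₁.map (D.inclusion S)) x = y :=
  (isInducedInclusion_inclusion D S).exists_cell fun v => ⟨⟨_, hy v⟩, rfl⟩

theorem vert_mem_range {D D' : DGra.{u}} {f : D ⟶ D'} {n : ℕ} (x : (N₁.obj D).cell n)
    (v : Cube n) : vert (ev (N₁.map f) x) v ∈ Set.range f.toFun := ⟨vert x v, rfl⟩

theorem InClosed.induce {D : DGra.{u}} {T : Set D.V} (hT : D.InClosed T) (S : Set D.V) :
    (D.induce S).InClosed {g | g.1 ∈ T} := fun _ _ h hg => hT h hg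

section Pushout

variable {H G H' G' : DGra.{u}} {i : H ⟶ G} {φ : H ⟶ H'} {φ' : G ⟶ G'} {i' : H' ⟶ G'}

theorem ev_pushout_comm (hsq : IsPushout i φ φ' i') {n : ℕ} (x : (N₁.obj H).cell n) :
    ev (N₁.map φ') (ev (N₁.map i) x) = ev (N₁.map i') (ev (N₁.map φ) x) :=
  cell_ext fun v => pushout_comm hsq (vert x v)

theorem isInducedInclusion_inr (hsq : IsPushout i φ φ' i') (hi : IsInducedInclusion i) :
    IsInducedInclusion i' := by
  have hinj := pushout_inr_injective hsq hi.1
  refine ⟨hinj, fun a b hab => ?_⟩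
  rcases pushout_arr_cases hsq hab with e | ⟨g, g', h, hg, hg'⟩ | ⟨h, h', harr, hh, hh'⟩
  · rw [hinj e]
    exact H'.refl _
  · obtain ⟨x, rfl⟩ := pushout_inl_eq_inr hsq hg
    obtain ⟨y, rfl⟩ := pushout_inl_eq_inr hsq hg'
    rw [pushout_comm hsq] at hg hg'
    rw [← hinj hg, ← hinj hg']
    exact φ.map_arr (hi.2 h)
  · rwa [← hinj hh, ← hinj hh']

/-- The map between the out-closure of `H` and `outPushout` induced by `φ'`. -/
def outMap (i : H ⟶ G) (φ' : G ⟶ G') (i' : H' ⟶ G') :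
    G.induce (G.outClosure (Set.range i.toFun)) ⟶ G'.induce (outPushout i φ' i') :=
  (⟨fun g => ⟨φ'.toFun g.1, Or.inr ⟨g.1, g.2, rfl⟩⟩, fun h => φ'.map_arr h⟩ :
    Hom (G.induce (G.outClosure (Set.range i.toFun))) (G'.induce (outPushout i φ' i')))

theorem outMap_comp_inclusion (i : H ⟶ G) (φ' : G ⟶ G') (i' : H' ⟶ G') :
    outMap i φ' i' ≫ G'.inclusion (outPushout i φ' i') =
      G.inclusion (G.outClosure (Set.range i.toFun)) ≫ φ' := rfl

theorem ev_outMap {n : ℕ}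
    (x : (N₁.obj (G.induce (G.outClosure (Set.range i.toFun)))).cell n) :
    ev (N₁.map (G'.inclusion (outPushout i φ' i'))) (ev (N₁.map (outMap i φ' i')) x) =
      ev (N₁.map φ') (ev (N₁.map (G.inclusion (G.outClosure (Set.range i.toFun)))) x) := by
  rw [← ev_comp, ← Functor.map_comp, outMap_comp_inclusion, Functor.map_comp, ev_comp]

/-- Every cube of the pushout lies in `outPushout` or is the image of a cube of `G` disjoint
from `H`. -/
theorem cell_pushout_cases (hsq : IsPushout i φ φ' i') (hi : G.InClosed (Set.range i.toFun))
    {n : ℕ} (y : (N₁.obj G').cell n) :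
    (∃ z, ev (N₁.map (G'.inclusion (outPushout i φ' i'))) z = y) ∨
      ∃ x, ev (N₁.map φ') x = y := by
  -- the two cases are distinguished by the least vertex of the cube
  by_cases hy : vert y (fun _ => false) ∈ outPushout i φ' i'
  · exact Or.inl (exists_cell_inclusion fun v =>
      (outClosed_outPushout hsq).vert_mem_of_le y (fun _ => Bool.false_le _) hy)
  · have hnot : ∀ v, vert y v ∉ Set.range i'.toFun := fun v hv =>
      hy (Or.inl ((inClosed_range_inr hsq hi).vert_mem_of_le y (fun _ => Bool.false_le _) hv))
    choose F hF using fun v => (pushout_cases hsq (vert y v)).resolve_right (hnot v)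
    have hF' : ∀ v, F v ∉ Set.range i.toFun := fun v hv =>
      hnot v (by rw [← hF]; exact (pushout_inl_mem_range_inr_iff hsq).2 hv)
    refine Or.inr ⟨ofVert F fun v l hl => exists_arr_of_notMem hsq (hF' _) (hF' _) ?_,
      cell_ext hF⟩
    rw [hF, hF]
    exact arr_vert y hl

/-- A cube of `G` whose image in the pushout does not lie in `outPushout` is determined by its
image. -/
theorem eq_of_ev_map_eq (hsq : IsPushout i φ φ' i') (hi : G.InClosed (Set.range i.toFun))
    {n : ℕ} {x x' : (N₁.obj G).cell n} (h : ev (N₁.map φ') x = ev (N₁.map φ') x')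
    (hx : ¬ ∃ z, ev (N₁.map (G'.inclusion (outPushout i φ' i'))) z = ev (N₁.map φ') x) :
    x = x' := by
  refine cell_ext fun v => pushout_inl_eq_inl hsq (fun hv => hx ?_)
    (congrArg (fun z : (N₁.obj G').cell n => vert z v) h)
  refine exists_cell_inclusion fun w =>
    (outClosed_outPushout hsq).vert_mem_of_le _ (fun _ => Bool.false_le (w _)) ?_
  have hv' := hi.vert_mem_of_le x (v := fun _ => false) (fun _ => Bool.false_le _) hv
  exact Or.inl ((pushout_inl_mem_range_inr_iff hsq).2 hv')

/-- The cubes of `G` whose image lies in `outPushout` are those of the out-closure of `H`. -/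
theorem exists_cell_outMap (hsq : IsPushout i φ φ' i') {n : ℕ} {x : (N₁.obj G).cell n}
    {z : (N₁.obj (G'.induce (outPushout i φ' i'))).cell n}
    (h : ev (N₁.map (G'.inclusion (outPushout i φ' i'))) z = ev (N₁.map φ') x) :
    ∃ x₀, ev (N₁.map (G.inclusion (G.outClosure (Set.range i.toFun)))) x₀ = x ∧
      ev (N₁.map (outMap i φ' i')) x₀ = z := by
  obtain ⟨x₀, rfl⟩ : ∃ x₀, ev (N₁.map (G.inclusion (G.outClosure (Set.range i.toFun)))) x₀ = x := by
    refine exists_cell_inclusion fun v => (pushout_inl_mem_outPushout_iff hsq).1 ?_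
    have h1 : vert (ev (N₁.map (G'.inclusion (outPushout i φ' i'))) z) v = φ'.toFun (vert x v) :=
      congrArg (fun y : (N₁.obj G').cell n => vert y v) h
    rw [← h1]
    exact (vert z v).2
  exact ⟨x₀, rfl, ev_map_injective (isInducedInclusion_inclusion G' _).1
    ((ev_outMap x₀).trans h.symm)⟩

/-- A compatible pair of sections of a Kan correspondence, over `G` and `H'`, is homotopic,
relatively to `H'`, to one which comes from a section over the pushout `G'`. -/
theorem exists_section_pushout (hi : IsInClosedCofibration i) (hsq : IsPushout i φ φ' i')
    {E : CSet.{u}} {R : Corr (N₁.obj G') E} (hR : R.KanFilling) {a : N₁.obj G ⟶ E}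
    {b : N₁.obj H' ⟶ E} (hab : N₁.map i ≫ a = N₁.map φ ≫ b)
    (ha : ∀ {n : ℕ} (x : (N₁.obj G).cell n), R.rel (ev (N₁.map φ') x) (ev a x))
    (hb : ∀ {n : ℕ} (x : (N₁.obj H').cell n), R.rel (ev (N₁.map i') x) (ev b x)) :
    ∃ κ : N₁.obj G' ⟶ E, (∀ {n : ℕ} (y : (N₁.obj G').cell n), R.rel y (ev κ y)) ∧
      N₁.map i' ≫ κ = b ∧ ∃ θ : N₁.obj G ⟶ path E, θ ≫ path.eval E false = a ∧
        θ ≫ path.eval E true = N₁.map φ' ≫ κ ∧ N₁.map i ≫ θ = N₁.map i ≫ a ≫ path.const E := by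
  have hind : IsInducedInclusion i := ⟨hi.1.1, hi.1.2.1⟩
  have hin : G.InClosed (Set.range i.toFun) := hi.1.2.2
  have hind' := isInducedInclusion_inr hsq hind
  have hab' : ∀ {n : ℕ} (x : (N₁.obj H).cell n), ev a (ev (N₁.map i) x) = ev b (ev (N₁.map φ) x) :=
    fun x => congrArg (fun f => ev f x) hab
  obtain ⟨η, hη, -, hev⟩ := hi.2.exists_deformation
  obtain ⟨η', hη', hev'⟩ := exists_deformation_outPushout hi.2 hsq
  let j := G.inclusion (G.outClosure (Set.range i.toFun))
  let j' := G'.inclusion (outPushout i φ' i')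
  have hj : Function.Injective j.toFun := (isInducedInclusion_inclusion _ _).1
  have hj' : Function.Injective j'.toFun := (isInducedInclusion_inclusion _ _).1
  let ψ := outMap i φ' i'
  have hψ : ∀ {n : ℕ} (x : (N₁.obj (G.induce (G.outClosure (Set.range i.toFun)))).cell n),
    ev (N₁.map j') (ev (N₁.map ψ) x) = ev (N₁.map φ') (ev (N₁.map j) x) := ev_outMap
  -- the extension `bhat` of `b` to `outPushout`
  let Γb : Corr (N₁.obj (G'.induce (outPushout i φ' i'))) E :=
    { rel := fun y e => ∃ x, ev (N₁.map i') x = ev (N₁.map j') y ∧ e = ev b x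
      res := by
        rintro m n y _ σ ⟨x, hx, rfl⟩
        exact ⟨x ◃ σ, by rw [ev_res, ev_res, hx], by rw [ev_res]⟩ }
  obtain ⟨bhat, hbhat, hbΓ⟩ := exists_extension ((inClosed_range_inr hsq hin).induce _) η' hη' hev'
    (hR.pullback (N₁.map j')) (Γ := Γb)
    (by
      rintro n y _ _ ⟨x, hx, rfl⟩ ⟨x', hx', rfl⟩
      rw [ev_map_injective hind'.1 (hx.trans hx'.symm)])
    (by
      rintro n y _ ⟨x, hx, rfl⟩
      change R.rel (ev (N₁.map j') y) _
      rw [← hx]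
      exact hb x)
    (by
      intro n y
      constructor
      · rintro ⟨_, x, hx, -⟩ v
        have h1 := vert_mem_range (f := i') x v
        rw [hx] at h1
        exact h1
      · intro hy
        obtain ⟨x, hx⟩ := hind'.exists_cell (y := ev (N₁.map j') y) hy
        exact ⟨_, x, hx, rfl⟩)
  -- a homotopy, relatively to `H`, from `a` to `bhat` on the out-closure of `H`
  obtain ⟨θ₀, hθ₀, hθΓ⟩ := exists_extension (hin.induce _) η hη hev
    (hR.pathEnds (N₁.map j ≫ N₁.map φ' ≫ path.const _)
      (fun ε => if ε then N₁.map ψ ≫ bhat else N₁.map j ≫ a) (by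
        intro ε n y
        rw [ev_comp, ev_comp, path.eval_const]
        cases ε
        · exact ha _
        · rw [← hψ]
          exact hbhat (ev (N₁.map ψ) y)))
    (Γ :=
      { rel := fun y e => (∃ x, ev (N₁.map i) x = ev (N₁.map j) y) ∧
          e = ev (path.const E) (ev a (ev (N₁.map j) y))
        res := by
          rintro m n y _ σ ⟨⟨x, hx⟩, rfl⟩
          exact ⟨⟨x ◃ σ, by rw [ev_res, ev_res, hx]⟩, by rw [ev_res, ev_res, ev_res]⟩ })
    (by
      rintro n y _ _ ⟨-, rfl⟩ ⟨-, rfl⟩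
      rfl)
    (by
      rintro n y _ ⟨⟨x, hx⟩, rfl⟩
      refine ⟨R.res _ (ha (ev (N₁.map j) y)), fun ε => ?_⟩
      rw [path.eval_const]
      cases ε
      · rfl
      · refine Eq.symm (hbΓ (y := ev (N₁.map ψ) y) ⟨ev (N₁.map φ) x, ?_, ?_⟩)
        · rw [← ev_pushout_comm hsq, hx, hψ]
        · rw [← hx, hab'])
    (by
      intro n y
      constructor
      · rintro ⟨_, ⟨x, hx⟩, -⟩ v
        have h1 := vert_mem_range (f := i) x v
        rw [hx] at h1
        exact h1
      · intro hy
        obtain ⟨x, hx⟩ := hind.exists_cell (y := ev (N₁.map j) y) hy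
        exact ⟨_, ⟨x, hx⟩, rfl⟩)
  -- the homotopy is extended to `G`
  obtain ⟨θ, hθ, hθθ₀⟩ := (hR.pathFrom (N₁.map φ' ≫ path.const _) a (by
      intro n y
      rw [ev_comp, path.eval_const]
      exact ha y)).exists_extension
    (Γ :=
      { rel := fun y e => ∃ x, ev (N₁.map j) x = y ∧ e = ev θ₀ x
        res := by
          rintro m n _ _ σ ⟨x, rfl, rfl⟩
          exact ⟨x ◃ σ, by rw [ev_res], by rw [ev_res]⟩ })
    (by
      rintro n y _ _ ⟨x, rfl, rfl⟩ ⟨x', hx', rfl⟩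
      rw [ev_map_injective hj hx'])
    (by
      rintro n _ _ ⟨x, rfl, rfl⟩
      exact ⟨(hθ₀ x).1, (hθ₀ x).2 false⟩)
  have hθ₁ : ∀ {n : ℕ} (x : (N₁.obj (G.induce (G.outClosure (Set.range i.toFun)))).cell n),
      ev (path.eval E true) (ev θ (ev (N₁.map j) x)) = ev bhat (ev (N₁.map ψ) x) := fun x => by
    rw [hθθ₀ (y := ev (N₁.map j) x) ⟨x, rfl, rfl⟩]
    exact (hθ₀ x).2 true
  -- the end of the homotopy and `bhat` are glued
  let Γglue : Corr (N₁.obj G') E :=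
    { rel := fun y e => (∃ x, ev (N₁.map φ') x = y ∧ e = ev (path.eval E true) (ev θ x)) ∨
        ∃ z, ev (N₁.map j') z = y ∧ e = ev bhat z
      res := by
        rintro m n _ _ σ (⟨x, rfl, rfl⟩ | ⟨x, rfl, rfl⟩)
        · exact Or.inl ⟨x ◃ σ, by rw [ev_res], by rw [ev_res, ev_res]⟩
        · exact Or.inr ⟨x ◃ σ, by rw [ev_res], by rw [ev_res]⟩ }
  have hmix : ∀ {n : ℕ} {x : (N₁.obj G).cell n}
      {z : (N₁.obj (G'.induce (outPushout i φ' i'))).cell n},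
      ev (N₁.map j') z = ev (N₁.map φ') x → ev (path.eval E true) (ev θ x) = ev bhat z := by
    intro n x z h
    obtain ⟨x₀, rfl, rfl⟩ := exists_cell_outMap hsq h
    exact hθ₁ x₀
  have hΓglue : Γglue.Functional := by
    rintro n y _ _ (⟨x, rfl, rfl⟩ | ⟨z, rfl, rfl⟩) (⟨x', hx', rfl⟩ | ⟨z', hz', rfl⟩)
    · by_cases hx : ∃ z, ev (N₁.map j') z = ev (N₁.map φ') x
      · obtain ⟨z, hz⟩ := hx
        rw [hmix hz, hmix (hz.trans hx'.symm)]
      · rw [eq_of_ev_map_eq hsq hin hx'.symm hx]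
    · exact hmix hz'
    · exact (hmix hx'.symm).symm
    · rw [ev_map_injective hj' hz']
  obtain ⟨κ, hκ⟩ := Corr.exists_hom_of_total hΓglue (fun n y => by
    rcases cell_pushout_cases hsq hin y with ⟨z, hz⟩ | ⟨x, hx⟩
    · exact ⟨_, Or.inr ⟨z, hz, rfl⟩⟩
    · exact ⟨_, Or.inl ⟨x, hx, rfl⟩⟩)
  refine ⟨κ, fun {n} y => ?_, hom_ext_cell fun n x => ?_, θ, hom_ext_cell fun n x => (hθ x).2,
    hom_ext_cell fun n x => hΓglue (Or.inl ⟨x, rfl, rfl⟩) (hκ n _), hom_ext_cell fun n x => ?_⟩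
  · rcases hκ n y with ⟨x, rfl, h⟩ | ⟨z, rfl, h⟩
    · have h1 := R.res (Box.coface (Fin.last n) true) (hθ x).1
      rw [h]
      have h2 : R.rel (ev (path.eval _ true) (ev (path.const _) (ev (N₁.map φ') x)))
        (ev (path.eval E true) (ev θ x)) := h1
      rwa [path.eval_const] at h2
    · rw [h]
      exact hbhat z
  · obtain ⟨z, hz⟩ : ∃ z, ev (N₁.map j') z = ev (N₁.map i') x :=
      exists_cell_inclusion fun v => Or.inl (vert_mem_range x v)
    rw [ev_comp, hΓglue (hκ n _) (Or.inr ⟨z, hz, rfl⟩)]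
    exact hbΓ ⟨x, hz.symm, rfl⟩
  · obtain ⟨z, hz⟩ : ∃ z, ev (N₁.map j) z = ev (N₁.map i) x :=
      exists_cell_inclusion fun v => G.subset_outClosure _ (vert_mem_range x v)
    rw [ev_comp, ev_comp, ev_comp, hθθ₀ ⟨z, hz, rfl⟩, hθΓ ⟨⟨x, hz.symm⟩, rfl⟩, hz]

end Pushout

end DGra

/-! ### The homotopy pushout -/

theorem CSet.weakEquivalence_id (X : CSet.{u}) : WeakEquivalence (𝟙 X) := by
  intro K _
  have : HomotopyClasses.precomp (𝟙 X) K = id := by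
    funext f
    induction f using Quot.inductionOn with
    | h f => exact congrArg (Quot.mk _) (Category.id_comp f)
  rw [this]
  exact Function.bijective_id

open CSet in
/-- The comparison map from the pushout of the nerves to the nerve of the pushout is a weak
equivalence. -/
theorem DGra.weakEquivalence_desc {H G H' G' : DGra.{u}} {i : H ⟶ G} {φ : H ⟶ H'} {φ' : G ⟶ G'}
    {i' : H' ⟶ G'} (hi : DGra.IsInClosedCofibration i) (hsq : IsPushout i φ φ' i')
    {P : CSet.{u}} {inl : N₁.obj G ⟶ P} {inr : N₁.obj H' ⟶ P}
    (hP : IsPushout (N₁.map i) (N₁.map φ) inl inr) {c : P ⟶ N₁.obj G'}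
    (hl : inl ≫ c = N₁.map φ') (hr : inr ≫ c = N₁.map i') : WeakEquivalence c := by
  intro K hK
  constructor
  · intro f g
    induction f using Quot.inductionOn with
    | h f =>
    induction g using Quot.inductionOn with
    | h g =>
    intro hfg
    obtain ⟨h, h₀, h₁⟩ : ElementaryHomotopic (c ≫ f) (c ≫ g) := (HomotopyClasses.mk_eq_iff hK).1 hfg
    -- a homotopy between `f` and `g` is a section of the correspondence of paths in `K`
    -- between the values of `f` and `g`
    have hend : ∀ ε, h ≫ path.eval K ε = c ≫ if ε then g else f := by
      rintro (_ | _)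
      · exact h₀
      · exact h₁
    obtain ⟨κ, hκ, -⟩ := exists_section_pushout hi hsq
      ((hK.kanFilling_univ (N₁.obj G')).pathEnds (path.const _) (fun ε => if ε then g else f)
        fun _ _ _ => trivial) (a := inl ≫ h) (b := inr ≫ h)
      (by rw [← Category.assoc, hP.w, Category.assoc])
      (fun {n} x => ⟨trivial, fun ε => by
        have h2 := congrArg (fun k => ev (inl ≫ k) x) (hend ε)
        rw [← Category.assoc inl c, hl] at h2
        exact h2⟩)
      (fun {n} x => ⟨trivial, fun ε => by
        have h2 := congrArg (fun k => ev (inr ≫ k) x) (hend ε)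
        rw [← Category.assoc inr c, hr] at h2
        exact h2⟩)
    exact Quot.sound ⟨κ, hom_ext_cell fun n y => (hκ y).2 false,
      hom_ext_cell fun n y => (hκ y).2 true⟩
  · intro k
    induction k using Quot.inductionOn with
    | h k =>
    have hab : N₁.map i ≫ inl ≫ k = N₁.map φ ≫ inr ≫ k := by
      rw [← Category.assoc, hP.w, Category.assoc]
    obtain ⟨κ, -, hκ, θ, hθ₀, hθ₁, hθ⟩ := exists_section_pushout hi hsq
      (hK.kanFilling_univ (N₁.obj G')) hab (fun _ => trivial) (fun _ => trivial)
    have hw : N₁.map i ≫ θ = N₁.map φ ≫ (inr ≫ k) ≫ path.const K := by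
      rw [hθ, ← Category.assoc, hab, Category.assoc]
    have hconst : ∀ ε, path.const K ≫ path.eval K ε = 𝟙 K := fun ε =>
      hom_ext_cell fun n x => path.eval_const x ε
    refine ⟨Quot.mk _ κ, Eq.symm (Quot.sound ⟨hP.desc θ _ hw, ?_, ?_⟩)⟩
    · refine hP.hom_ext ?_ ?_
      · rw [← Category.assoc, hP.inl_desc, hθ₀]
      · rw [← Category.assoc, hP.inr_desc, Category.assoc, hconst, Category.comp_id]
    · refine hP.hom_ext ?_ ?_
      · rw [← Category.assoc, hP.inl_desc, hθ₁, ← Category.assoc, hl]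
      · rw [← Category.assoc, hP.inr_desc, Category.assoc, hconst, Category.comp_id,
          ← Category.assoc, hr, hκ]

/-- The functor `N₁` sends pushouts of digraphs along in-closed cofibrations to homotopy pushouts
of cubical sets. -/
theorem mainTheorem8 {H G H' G' : DGra.{u}} (i : H ⟶ G) (φ : H ⟶ H') (φ' : G ⟶ G') (i' : H' ⟶ G')
    (hi : DGra.IsInClosedCofibration i) (hsq : IsPushout i φ φ' i') :
    CSet.IsHomotopyPushout (DGra.N₁.map i) (DGra.N₁.map φ) (DGra.N₁.map φ') (DGra.N₁.map i') := by
  have hw : DGra.N₁.map i ≫ DGra.N₁.map φ' = DGra.N₁.map φ ≫ DGra.N₁.map i' := by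
    rw [← Functor.map_comp, hsq.w, Functor.map_comp]
  have hP := IsPushout.of_hasPushout (DGra.N₁.map i) (DGra.N₁.map φ)
  -- the nerve of `i` is already a monomorphism
  exact ⟨hw, _, _, DGra.N₁.map i, 𝟙 _, _, _, hP.desc _ _ hw, DGra.mono_map hi.1.1,
    CSet.weakEquivalence_id _, Category.comp_id _, hP,
    (hP.inl_desc _ _ hw).trans (Category.id_comp _).symm, hP.inr_desc _ _ hw,
    DGra.weakEquivalence_desc hi hsq hP (hP.inl_desc _ _ hw) (hP.inr_desc _ _ hw)⟩
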